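/- Let $\mathcal S$ be a triangulated category with small coproducts and shift $[1]$. **Notation.** An object $X$ is *compact* if $\operatorname{Hom}(X,-)$ commutes with small coproducts; $\mathcal S^c$ is the triangulated category of compact objects. For $G\in\mathcal S$ and a set $I\subseteq\mathbb Z$ of integers, let $\operatorname{Coprod}(G[I])$ be the smallest full subcategory containing all $G[-i]$, $i\in I$, and closed under small coproducts and extensions, and let $\overline{\langle G\rangle}^{I}$ be the class of direct summands of its objects. $G$ is a *compact generator* if $G\in\mathcal S^c$ and $\mathcal S=\overline{\langle G\rangle}^{\mathbb Z}$; it is *bounded* if moreover $\operatorname{Hom}(G,G[i])=0$ for $i\ll0$. $\mathcal S$ is *weakly approximable* if there are a compact generator $G'$, a $t$-structure $(\mathcal D^{\le0},\mathcal D^{\ge1})$ and an integer $A>0$ with $G'[A]\in\mathcal D^{\le0}$, $\operatorname{Hom}(G'[-A],\mathcal D^{\le0})=0$, such that every $F\in\mathcal D^{\le0}$ lies in a triangle $E\to F\to D\to E[1]$ with $E\in\overline{\langle G'\rangle}^{[-A,A]}$ and $D\in\mathcal D^{\le-1}$. Fix a compact generator $G$. Let $\mathcal S^{\le0}=\operatorname{Coprod}(G[(-\infty,0]])$,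 $\mathcal S^{\ge1}=\{X\mid\operatorname{Hom}(G[i],X)=0\ \forall i\ge0\}$, $\mathcal S^{\le n}=\mathcal S^{\le0}[-n]$, $\mathcal S^{\ge n+1}=\mathcal S^{\ge1}[-n]$ (the $t$-structure generated by $G$). $X$ is *bounded*, $X\in\mathcal S^b$, if $X[n]\in\mathcal S^{\le0}$ and $X[-n]\in\mathcal S^{\ge1}$ for some $n\ge0$; $X$ is *strongly bounded*, $X\in\mathcal S^{\rm sb}$, if $X\in\overline{\langle G\rangle}^{[-i,i]}$ for some $i\ge0$. Put $$\operatorname{pd}_G(X)=\inf\{n\in\mathbb Z\mid\operatorname{Hom}(X,Y[i])=0\ \forall i>n,\ \forall Y\in\mathcal S^b\cap\mathcal S^{\le0}\}\in\mathbb Z\cup\{\pm\infty\},$$ $$\operatorname{fpd}(\mathcal S,G)=\sup\{\operatorname{pd}_G(X)\mid X\in\mathcal S^c\cap\mathcal S^b\cap\mathcal S^{\ge0},\ \operatorname{pd}_G(X)<+\infty\},$$ $$o^+(G)=\inf\{c\in\mathbb N\mid\operatorname{Hom}(G,G[i])=0\ \forall i>c\},$$ and let $a(G)=\sup_{M\in\mathcal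 S^{\le0}}b(M)$, where $b(M)$ is the infimum of the integers $n\ge0$ for which there is a triangle $E\to M\to D\to E[1]$ with $E\in\overline{\langle G\rangle}^{[-n,n]}$ and $D\in\mathcal S^{\le-1}$. Finally, for a triangulated category $\mathcal T$ and $G\in\mathcal T$ let $\langle G\rangle^{[0,+\infty)}$ be the smallest full subcategory of $\mathcal T$ containing $G$ and closed under extensions, direct summands and $[-1]$, and let $$\operatorname{fd}(\mathcal T,G)=\inf\{n\in\mathbb N\mid\text{every }X\in\mathcal T\text{ with }\operatorname{Hom}(G[i],X)=0\ \forall i\ge1\text{ lies in }\langle G\rangle^{[0,+\infty)}[n]\}\in\mathbb N\cup\{+\infty\}$$ (here $0\in\mathbb N$). **Proposition.** Let $\mathcal S$ be weakly approximable with a bounded compact generator $G$. (1) Let $M\in\mathcal S^b$. Then $\operatorname{pd}_G(M)<+\infty$ if and only if $M\in\mathcal S^{\rm sb}$. Moreover, $\operatorname{pd}_G(M)=-\infty$ if and only if $M=0$. (2) $\operatorname{fd}(\mathcal S^c,G)\le\max\{0,\ \operatorname{fpd}(\mathcal S,G)+a(G)\}$ and $\operatorname{fpd}(\mathcal S,G)\le\operatorname{fd}(\mathcal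 S^c,G)+o^+(G)$. In particular, $\operatorname{fd}(\mathcal S^c,G)<+\infty$ if and only if $\operatorname{fpd}(\mathcal S,G)<+\infty$; if $\mathcal S\ne0$, then $\operatorname{fd}(\mathcal S^c,G)$ is finite if and only if $\operatorname{fpd}(\mathcal S,G)$ is an integer. -/

import Mathlib

open CategoryTheory CategoryTheory.Limits CategoryTheory.Pretriangulated
  CategoryTheory.Triangulated ZeroObject

universe v u

namespace FinDimTri

noncomputable section

/-! ### Compact objects -/

section Compact

variable {C : Type u} [Category.{v} C] [Preadditive C] [HasCoproducts.{v} C]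

open Classical in
/-- The canonical homomorphism from the direct sum of the groups `Hom(X, Y j)` to the group
`Hom(X, ∐ Y)`, given on the `j`-th summand by composition with the `j`-th inclusion. -/
def coprodComparison (X : C) {J : Type v} (Y : J → C) :
    (DirectSum J fun j => (X ⟶ Y j)) →+ (X ⟶ ∐ Y) :=
  DirectSum.toAddMonoid fun j => Preadditive.rightComp X (Sigma.ι Y j)

/-- `X` is compact if `Hom(X, -)` commutes with small coproducts. -/
def IsCompactObject : ObjectProperty C := fun X =>
  ∀ (J : Type v) (Y : J → C), Function.Bijective (coprodComparison X Y)

open Classical in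
/-- The idempotent endomorphism of a coproduct given by a finite set of summands. -/
def finProj {J : Type v} (Y : J → C) (s : Finset J) : ∐ Y ⟶ ∐ Y :=
  ∑ j ∈ s, Sigma.π Y j ≫ Sigma.ι Y j

open Classical in
lemma ι_finProj {J : Type v} (Y : J → C) (s : Finset J) (j : J) :
    Sigma.ι Y j ≫ finProj Y s = if j ∈ s then Sigma.ι Y j else 0 := by
  rw [finProj, Preadditive.comp_sum]
  split_ifs with h
  · rw [Finset.sum_eq_single_of_mem j h]
    · simp
    · intro b _ hb
      rw [Sigma.ι_π_of_ne_assoc _ hb.symm, zero_comp]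
  · refine Finset.sum_eq_zero fun b hb => ?_
    have hne : j ≠ b := fun e => h (e ▸ hb)
    rw [Sigma.ι_π_of_ne_assoc _ hne, zero_comp]

open Classical in
lemma coprodComparison_of (X : C) {J : Type v} (Y : J → C) (j : J) (f : X ⟶ Y j) :
    coprodComparison X Y (DirectSum.of (fun j => (X ⟶ Y j)) j f) = f ≫ Sigma.ι Y j :=
  DirectSum.toAddMonoid_of _ _ _

open Classical in
lemma coprodComparison_comp_π (X : C) {J : Type v} (Y : J → C)
    (x : DirectSum J fun j => (X ⟶ Y j)) (i : J) :
    coprodComparison X Y x ≫ Sigma.π Y i = x i := by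
  induction x using DirectSum.induction_on with
  | zero => simp
  | of j f =>
    rw [coprodComparison_of]
    by_cases h : j = i
    · subst h
      simp
    · rw [DirectSum.of_eq_of_ne _ _ _ (Ne.symm h)]
      rw [Category.assoc, Sigma.ι_π_of_ne _ h, comp_zero]
  | add a b ha hb => rw [map_add, Preadditive.add_comp, ha, hb, DirectSum.add_apply]

open Classical in
lemma isCompactObject_iff (X : C) : IsCompactObject X ↔
    ∀ (J : Type v) (Y : J → C) (f : X ⟶ ∐ Y), ∃ s : Finset J, f ≫ finProj Y s = f := by
  refine forall_congr' fun J => forall_congr' fun Y => ⟨fun h f => ?_, fun h => ⟨?_, ?_⟩⟩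
  · obtain ⟨x, rfl⟩ := h.2 f
    clear h
    induction x using DirectSum.induction_on with
    | zero => exact ⟨∅, by simp⟩
    | of j g =>
      refine ⟨{j}, ?_⟩
      rw [coprodComparison_of]
      rw [Category.assoc, ι_finProj, if_pos (Finset.mem_singleton_self j)]
    | add a b ha hb =>
      obtain ⟨s, hs⟩ := ha
      obtain ⟨t, ht⟩ := hb
      have key : ∀ (r q : Finset J), finProj Y r ≫ finProj Y (r ∪ q) = finProj Y r := by
        intro r q
        refine Sigma.hom_ext _ _ fun j => ?_
        rw [reassoc_of% (ι_finProj Y r j), ι_finProj]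
        split_ifs with hj
        · rw [ι_finProj, if_pos (Finset.mem_union_left _ hj)]
        · rw [zero_comp]
      refine ⟨s ∪ t, ?_⟩
      rw [map_add, Preadditive.add_comp]
      congr 1
      · rw [← hs, Category.assoc, key]
      · rw [← ht, Category.assoc, Finset.union_comm, key]
  · rw [injective_iff_map_eq_zero]
    intro x hx
    refine DFinsupp.ext fun i => ?_
    rw [← coprodComparison_comp_π X Y x i, hx]
    simp
  · intro f
    obtain ⟨s, hs⟩ := h f
    refine ⟨∑ j ∈ s, DirectSum.of (fun j => (X ⟶ Y j)) j (f ≫ Sigma.π Y j), ?_⟩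
    rw [map_sum]
    conv_rhs => rw [← hs, finProj, Preadditive.comp_sum]
    refine Finset.sum_congr rfl fun j _ => ?_
    rw [coprodComparison_of, Category.assoc]

end Compact

variable {C : Type u} [Category.{v} C] [Preadditive C] [HasZeroObject C] [HasShift C ℤ]
  [∀ n : ℤ, (shiftFunctor C n).Additive] [Pretriangulated C]

section CompactTriangulated

variable [HasCoproducts.{v} C]

instance : (IsCompactObject (C := C)).IsClosedUnderIsomorphisms where
  of_iso {X Y} e hX := by
    rw [isCompactObject_iff] at hX ⊢
    intro J Z f
    obtain ⟨s, hs⟩ := hX J Z (e.hom ≫ f)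
    refine ⟨s, ?_⟩
    rwa [Category.assoc, Iso.cancel_iso_hom_left] at hs

instance : (IsCompactObject (C := C)).IsStableUnderShift ℤ where
  isStableUnderShiftBy n := ⟨fun X hX => by
    rw [ObjectProperty.prop_shift_iff]
    rw [isCompactObject_iff] at hX ⊢
    intro J Y f
    let A := (shiftEquiv C n).toAdjunction
    let g : X ⟶ (∐ Y)⟦-n⟧ := A.homEquiv _ _ f
    have : PreservesColimitsOfSize.{v, v} (shiftFunctor C (-n)) := inferInstance
    let e := PreservesCoproduct.iso (shiftFunctor C (-n)) Y
    obtain ⟨s, hs⟩ := hX J (fun j => (Y j)⟦-n⟧) (g ≫ e.hom)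
    have he : ∀ j, Sigma.ι (fun j => (Y j)⟦-n⟧) j ≫ e.inv = (Sigma.ι Y j)⟦-n⟧' := by
      intro j
      simp [e]
    have comm : finProj (fun j => (Y j)⟦-n⟧) s ≫ e.inv = e.inv ≫ (finProj Y s)⟦-n⟧' := by
      classical
      refine Sigma.hom_ext _ _ fun j => ?_
      rw [reassoc_of% (ι_finProj (fun j => (Y j)⟦-n⟧) s j), reassoc_of% (he j),
        ← Functor.map_comp, ι_finProj]
      split_ifs
      · rw [he]
      · simp
    refine ⟨s, (A.homEquiv _ _).injective ?_⟩
    have hg : g ≫ (finProj Y s)⟦-n⟧' = g := by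
      have h2 := congrArg (· ≫ e.inv) hs
      simpa [comm] using h2
    exact (A.homEquiv_naturality_right f (finProj Y s)).trans hg⟩

/-- The compact objects form a triangulated subcategory. -/
instance : (IsCompactObject (C := C)).IsTriangulated where
  exists_zero := ⟨0, isZero_zero C, by
    rw [isCompactObject_iff]
    exact fun J Y f => ⟨∅, (isZero_zero C).eq_of_src _ _⟩⟩
  ext₂' T hT h₁ h₃ := by
    classical
    refine ObjectProperty.le_isoClosure _ _ ?_
    rw [isCompactObject_iff] at h₁ h₃ ⊢
    intro J Y f
    obtain ⟨s, hs⟩ := h₁ J Y (T.mor₁ ≫ f)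
    obtain ⟨g, hg⟩ := Triangle.yoneda_exact₂ T hT (f - f ≫ finProj Y s)
      (by rw [Preadditive.comp_sub, ← Category.assoc, hs, sub_self])
    obtain ⟨t, ht⟩ := h₃ J Y g
    have key : finProj Y (s ∪ t) =
        finProj Y s + finProj Y t - finProj Y s ≫ finProj Y t := by
      refine Sigma.hom_ext _ _ fun j => ?_
      rw [Preadditive.comp_sub, Preadditive.comp_add, reassoc_of% (ι_finProj Y s j),
        ι_finProj, ι_finProj, ι_finProj]
      by_cases hjs : j ∈ s <;> by_cases hjt : j ∈ t <;> simp [hjs, hjt, ι_finProj]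
    have h4 : (f - f ≫ finProj Y s) ≫ finProj Y t = f - f ≫ finProj Y s := by
      rw [hg, Category.assoc, ht]
    rw [Preadditive.sub_comp, Category.assoc] at h4
    refine ⟨s ∪ t, ?_⟩
    rw [key, Preadditive.comp_sub, Preadditive.comp_add, add_sub_assoc, h4]
    abel

variable (C) in
/-- The triangulated category of compact objects. -/
abbrev Compacts := (IsCompactObject (C := C)).FullSubcategory

end CompactTriangulated

/-! ### Subcategories generated by an object -/

/-- For a set `I` of integers, the class of the objects `G[-i]` with `i ∈ I`
(up to isomorphism). For `I = {i | A ≤ i ≤ B}` this is `G[A, B]`. -/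
def shiftsIn (G : C) (I : Set ℤ) : ObjectProperty C := fun X =>
  ∃ i ∈ I, Nonempty (X ≅ G⟦-i⟧)

/-- `Coprod P`: the smallest full subcategory containing `P` and closed under (small)
coproducts and extensions. -/
inductive Coprod [HasCoproducts.{v} C] (P : ObjectProperty C) : C → Prop
  | base (X : C) : P X → Coprod P X
  | coprod {J : Type v} (Y : J → C) : (∀ j, Coprod P (Y j)) → Coprod P (∐ Y)
  | ext (T : Triangle C) : T ∈ distTriang C → Coprod P T.obj₁ → Coprod P T.obj₃ →
      Coprod P T.obj₂

/-- The class of direct summands of objects of `Coprod (G[-i], i ∈ I)`. -/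
def bigGen [HasCoproducts.{v} C] (G : C) (I : Set ℤ) : ObjectProperty C :=
  ObjectProperty.retractClosure (Coprod (shiftsIn G I))

/-- The smallest full subcategory containing `G` and closed under extensions, direct summands
and negative shifts. -/
inductive NonnegGen (G : C) : C → Prop
  | base : NonnegGen G G
  | shift (X : C) : NonnegGen G X → NonnegGen G (X⟦(-1 : ℤ)⟧)
  | retract (X Y : C) : Retract X Y → NonnegGen G Y → NonnegGen G X
  | ext (T : Triangle C) : T ∈ distTriang C → NonnegGen G T.obj₁ → NonnegGen G T.obj₃ →
      NonnegGen G T.obj₂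

/-- The finitistic dimension of a triangulated category at an object `G`: the least natural
number `n` such that every `X` with `Hom(G[i], X) = 0` for all `i ≥ 1` is of the form `Z[n]`
with `Z` in `NonnegGen G` (that is, `X[-n]` lies in `NonnegGen G`); it is `⊤` if there is no
such `n`. -/
def findim (G : C) : ℕ∞ :=
  ⨅ (n : ℕ) (_ : (shiftsIn G (Set.Iic (-1))).rightOrthogonal ≤
    ObjectProperty.shift (NonnegGen G) (-(n : ℤ))), (n : ℕ∞)

/-- The upper self-orthogonal index of `G`. -/
def upperIndex (G : C) : ℕ∞ :=
  ⨅ (c : ℕ) (_ : ∀ i : ℤ, (c : ℤ) < i → ∀ f : G ⟶ G⟦i⟧, f = 0), (c : ℕ∞)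

/-! ### The t-structure generated by an object -/

section Generated

variable [HasCoproducts.{v} C]

/-- The objects in degrees `≤ n` for the t-structure generated by `G`: those `X` with
`X[n]` in `Coprod (G[i], i ≥ 0)`. -/
def genLE (G : C) (n : ℤ) : ObjectProperty C :=
  ObjectProperty.shift (Coprod (shiftsIn G (Set.Iic 0))) n

/-- The objects in degrees `≥ n` for the t-structure generated by `G`: those `X` such that
`X[n - 1]` is right orthogonal to all `G[i]`, `i ≥ 0`. -/
def genGE (G : C) (n : ℤ) : ObjectProperty C :=
  (shiftsIn G (Set.Iic 0)).rightOrthogonal.shift (n - 1)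

/-- Bounded objects for the t-structure generated by `G`. -/
def IsBoundedObject (G : C) : ObjectProperty C := fun X =>
  ∃ n : ℕ, genLE G 0 (X⟦(n : ℤ)⟧) ∧ genGE G 1 (X⟦(-n : ℤ)⟧)

/-- Strongly bounded objects. -/
def IsStronglyBounded (G : C) : ObjectProperty C := fun X =>
  ∃ i : ℕ, bigGen G (Set.Icc (-i : ℤ) i) X

/-- The projective dimension of `X` with respect to `G`, with values in `ℤ ∪ {±∞}`. -/
def projDim (G X : C) : EReal :=
  ⨅ (n : ℤ) (_ : ∀ i : ℤ, n < i → ∀ Y : C, IsBoundedObject G Y → genLE G 0 Y →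
    ∀ f : X ⟶ Y⟦i⟧, f = 0), (((n : ℤ) : ℝ) : EReal)

/-- The finitistic dimension of `C` with respect to `G`, defined through projective dimensions
of compact objects. -/
def fpd (G : C) : EReal :=
  ⨆ (X : C) (_ : IsCompactObject X ∧ IsBoundedObject G X ∧ genGE G 0 X ∧ projDim G X < ⊤),
    projDim G X

/-- The approximable index of `M`. -/
def approxIndexObj (G M : C) : ℕ∞ :=
  ⨅ (n : ℕ) (_ : ObjectProperty.extensionProduct (bigGen G (Set.Icc (-n : ℤ) n))
    (genLE G (-1)) M), (n : ℕ∞)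

/-- The `G`-approximable index. -/
def approxIndex (G : C) : ℕ∞ :=
  ⨆ (M : C) (_ : genLE G 0 M), approxIndexObj G M

/-- `G` is a compact generator. -/
def IsCompactGenerator (G : C) : Prop :=
  IsCompactObject G ∧ ∀ X : C, bigGen G Set.univ X

/-- A bounded compact generator: moreover `Hom(G, G[i]) = 0` for `i ≪ 0`. -/
def IsBoundedCompactGenerator (G : C) : Prop :=
  IsCompactGenerator G ∧ ∃ n : ℤ, ∀ i : ℤ, i ≤ n → ∀ f : G ⟶ G⟦i⟧, f = 0

variable (C) in
/-- Weakly approximable triangulated categories. -/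
def IsWeaklyApproximable : Prop :=
  ∃ (G : C) (t : TStructure C) (A : ℕ), IsCompactGenerator G ∧ 0 < A ∧
    t.le 0 (G⟦(A : ℤ)⟧) ∧
    (∀ Y : C, t.le 0 Y → ∀ f : G⟦(-A : ℤ)⟧ ⟶ Y, f = 0) ∧
    ∀ F : C, t.le 0 F →
      ObjectProperty.extensionProduct (bigGen G (Set.Icc (-A : ℤ) A)) (t.le (-1)) F

end Generated

/-- The extended natural numbers inside the extended reals. -/
def toEReal (n : ℕ∞) : EReal := ((n : ENNReal) : EReal)

end

end FinDimTri

/-! Write `bigGen G I` for what `G[-i]`, `i ∈ I`, builds from coproducts, extensions and summands.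
Everything is bookkeeping of intervals `I`.

Weak approximability is given for some other generator and t-structure. Two compact generators build
each other within finite intervals, and the given aisle agrees with `bigGen G' (Set.Iic _)` up to a
bounded shift; the hard inclusion `le_zero_le` presents an object as the homotopy colimit of its
approximations. So the t-structure generated by `G` is approximable too (`exists_forall_genLE`), and
`Hom(G, G[i]) = 0` for `i ≫ 0`.

If a bounded `M` has projective dimension at most `n`, iterated approximation gives a triangle `E →
M → D → E[1]` with `D` bounded and in degrees `≤ -n-1`. The map `M → D` vanishes, so `M` is a
summand of `E`, and `M ∈ bigGen G [-n-a, b]` for some `b` (`IsProjBound.bigGen_Icc`). Conversely,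
membership in `bigGen G [p, ∞)` bounds the projective dimension by `o⁺(G) - p`. This gives (1).

For (2), a compact object lies in `bigGen G [0, ∞)` exactly when finitely many steps inside the
compact objects build it (`exists_factorization`). Hence `fd ≤ n` means that every compact object in
degrees `≥ 0` lies in `bigGen G [-n, ∞)`, and the two estimates above become the two inequalities.
-/

namespace FinDimTri

/-! ### Classes closed under coproducts and extensions -/

section ClosureProperties

variable {C : Type u} [Category.{v} C] [Preadditive C] [HasZeroObject C] [HasShift C ℤ]
  [∀ n : ℤ, (shiftFunctor C n).Additive] [Pretriangulated C]

lemma distinguished_of_iso_of_isZero {X Y Z : C} (e : X ≅ Y) (hZ : IsZero Z) :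
    Triangle.mk e.hom (0 : Y ⟶ Z) 0 ∈ distTriang C := by
  rw [Triangle.distinguished_iff_of_isZero₃ _ hZ]
  exact inferInstanceAs (IsIso e.hom)

variable [HasCoproducts.{v} C]

/-- A class of objects closed under small coproducts and extensions. -/
structure ClosedUnderCoprodExt (Q : ObjectProperty C) : Prop where
  coprod : ∀ {J : Type v} (Y : J → C), (∀ j, Q (Y j)) → Q (∐ Y)
  ext : ∀ (T : Triangle C), T ∈ distTriang C → Q T.obj₁ → Q T.obj₃ → Q T.obj₂

namespace ClosedUnderCoprodExt

variable {Q : ObjectProperty C} (hQ : ClosedUnderCoprodExt Q)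
include hQ

/-- The empty coproduct is a zero object. Closure under isomorphism then follows by extending by
zero, so it need not be assumed. -/
lemma exists_isZero : ∃ Z : C, Q Z ∧ IsZero Z :=
  ⟨∐ (fun j : PEmpty.{v + 1} => j.elim), hQ.coprod _ (fun j => j.elim),
    (IsZero.iff_id_eq_zero _).2 (Sigma.hom_ext _ _ fun j => j.elim)⟩

lemma of_iso {X Y : C} (e : X ≅ Y) (hX : Q X) : Q Y := by
  obtain ⟨Z, hZ, hZ'⟩ := hQ.exists_isZero
  exact hQ.ext _ (distinguished_of_iso_of_isZero e hZ') hX hZ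

lemma of_isZero {X : C} (hX : IsZero X) : Q X := by
  obtain ⟨Z, hZ, hZ'⟩ := hQ.exists_isZero
  exact hQ.of_iso (hZ'.iso hX) hZ

lemma shift (n : ℤ) : ClosedUnderCoprodExt (Q.shift n) where
  coprod {J} Y hY := by
    have : PreservesColimitsOfSize.{v, v} (shiftFunctor C n) := inferInstance
    exact hQ.of_iso (PreservesCoproduct.iso (shiftFunctor C n) Y).symm (hQ.coprod _ hY)
  ext T hT h₁ h₃ := hQ.ext _ (Triangle.shift_distinguished T hT n) h₁ h₃

lemma coprod_le {P : ObjectProperty C} (h : P ≤ Q) : Coprod P ≤ Q := by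
  intro X hX
  induction hX with
  | base X hX => exact h _ hX
  | coprod Y _ ih => exact hQ.coprod Y ih
  | ext T hT _ _ h₁ h₃ => exact hQ.ext T hT h₁ h₃

lemma extensionProduct_le {P P' : ObjectProperty C} (h : P ≤ Q) (h' : P' ≤ Q) :
    ObjectProperty.extensionProduct P P' ≤ Q :=
  fun _ ⟨_, _, _, _, _, hT, hY, hZ⟩ => hQ.ext _ hT (h _ hY) (h' _ hZ)

lemma retractClosure : ClosedUnderCoprodExt Q.retractClosure where
  coprod {J} Y hY := by
    choose Z hZ r using hY
    have r' := fun j => (r j).some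
    refine ⟨_, hQ.coprod Z hZ, ⟨⟨Limits.Sigma.map fun j => (r' j).i,
      Limits.Sigma.map fun j => (r' j).r, ?_⟩⟩⟩
    refine Sigma.hom_ext _ _ fun j => ?_
    simp
  ext T hT h₁ h₃ := by
    obtain ⟨Z, hZ, r⟩ := ObjectProperty.extensionProduct_retractClosure_retractClosure_le Q Q
      _ ⟨_, _, _, _, _, hT, h₁, h₃⟩
    exact ⟨Z, hQ.extensionProduct_le le_rfl le_rfl _ hZ, r⟩

/-- The Eilenberg swindle. -/
lemma of_retract (hs : Q ≤ Q.shift (1 : ℤ)) {X Z : C} (r : Retract X Z) (hZ : Q Z) : Q X := by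
  let Y : ULift.{v} ℕ → C := fun _ => Z
  let ι : ℕ → (Z ⟶ ∐ Y) := fun n => Sigma.ι Y ⟨n⟩
  let d {B : C} (g : ℕ → (Z ⟶ B)) : (∐ Y) ⟶ B := Sigma.desc fun j => g j.down
  have hd {B : C} (g : ℕ → (Z ⟶ B)) (n : ℕ) : ι n ≫ d g = g n := Sigma.ι_desc _ _
  have hext {B : C} (f g : ∐ Y ⟶ B) (h : ∀ n, ι n ≫ f = ι n ≫ g) : f = g :=
    Sigma.hom_ext _ _ fun j => h j.down
  have hr : r.i ≫ r.r = 𝟙 X := r.retract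
  have hr' {B : C} (g : X ⟶ B) : r.i ≫ r.r ≫ g = g := by rw [← Category.assoc, hr, Category.id_comp]
  -- On each copy of `Z`, `φ` moves the summand `X` one place up and fixes its complement; `s` fills
  -- the vacant `X` in place `0`. The inverse is given by `ψ` and `p`.
  let φ' : ℕ → (Z ⟶ ∐ Y) := fun n => ι n - r.r ≫ r.i ≫ ι n + r.r ≫ r.i ≫ ι (n + 1)
  let ψ' : ℕ → (Z ⟶ ∐ Y) := fun n => ι n - r.r ≫ r.i ≫ ι n +
    (match n with | 0 => 0 | n + 1 => r.r ≫ r.i ≫ ι n)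
  let p' : ℕ → (Z ⟶ X) := fun n => match n with | 0 => r.r | _ + 1 => 0
  let φ := d φ'
  let ψ := d ψ'
  let p := d p'
  let s : X ⟶ ∐ Y := r.i ≫ ι 0
  have hφ : ∀ n, ι n ≫ φ = ι n - r.r ≫ r.i ≫ ι n + r.r ≫ r.i ≫ ι (n + 1) := hd φ'
  have hψ0 : ι 0 ≫ ψ = ι 0 - r.r ≫ r.i ≫ ι 0 + 0 := hd ψ' 0
  have hψ : ∀ n, ι (n + 1) ≫ ψ = ι (n + 1) - r.r ≫ r.i ≫ ι (n + 1) + r.r ≫ r.i ≫ ι n :=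
    fun n => hd ψ' (n + 1)
  have hp0 : ι 0 ≫ p = r.r := hd p' 0
  have hp : ∀ n, ι (n + 1) ≫ p = 0 := fun n => hd p' (n + 1)
  let e : (∐ Y) ⊞ X ≅ ∐ Y :=
    { hom := biprod.desc φ s
      inv := biprod.lift ψ p
      hom_inv_id := by
        refine biprod.hom_ext' _ _ (biprod.hom_ext _ _ (hext _ _ fun n => ?_)
          (hext _ _ fun n => ?_)) (biprod.hom_ext _ _ ?_ ?_)
        · cases n <;>
          simp [reassoc_of% hφ, hψ0, hψ, hr', Preadditive.add_comp, Preadditive.sub_comp,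
            Preadditive.comp_add, Preadditive.comp_sub]
        · cases n <;>
          simp [reassoc_of% hφ, hp0, hp, hr, Preadditive.add_comp, Preadditive.sub_comp]
        · simp [s, hψ0, hr', Preadditive.comp_sub]
        · simp [s, hp0, hr]
      inv_hom_id := by
        refine hext _ _ fun n => ?_
        cases n <;>
        simp [biprod.lift_desc, reassoc_of% hψ0, reassoc_of% hψ, reassoc_of% hp0,
          reassoc_of% hp, hφ, hr', s, Preadditive.add_comp, Preadditive.sub_comp,
            Preadditive.comp_add, Preadditive.comp_sub] }
  have hW : Q (∐ Y) := hQ.coprod Y fun _ => hZ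
  -- In the rotated split triangle, `X` sits between `∐ Y ⊞ X ≅ ∐ Y` and `(∐ Y)[1]`.
  exact hQ.ext _ (rot_of_distTriang _ (binaryBiproductTriangle_distinguished (∐ Y) X))
    (hQ.of_iso e.symm hW) (hs _ hW)

end ClosedUnderCoprodExt

lemma closedUnderCoprodExt_coprod (P : ObjectProperty C) : ClosedUnderCoprodExt (Coprod P) where
  coprod := Coprod.coprod
  ext := Coprod.ext

lemma closedUnderCoprodExt_bigGen (G : C) (I : Set ℤ) : ClosedUnderCoprodExt (bigGen G I) :=
  (closedUnderCoprodExt_coprod _).retractClosure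

lemma coprod_le_bigGen (G : C) (I : Set ℤ) : Coprod (shiftsIn G I) ≤ bigGen G I :=
  ObjectProperty.le_retractClosure _

omit [HasZeroObject C] [Preadditive C] [∀ n : ℤ, (shiftFunctor C n).Additive]
  [Pretriangulated C] [HasCoproducts.{v} C] in
lemma shiftsIn_shift (G : C) (I : Set ℤ) (n : ℤ) {X : C} (hX : shiftsIn G I X) :
    shiftsIn G ((· + n) ⁻¹' I) (X⟦n⟧) := by
  obtain ⟨i, hi, ⟨e⟩⟩ := hX
  exact ⟨i - n, by simpa using hi, ⟨(shiftFunctor C n).mapIso e ≪≫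
    ((shiftFunctorAdd' C (-i) n (-(i - n)) (by lia)).app G).symm⟩⟩

lemma coprod_shift (G : C) (I : Set ℤ) (n : ℤ) {X : C} (hX : Coprod (shiftsIn G I) X) :
    Coprod (shiftsIn G ((· + n) ⁻¹' I)) (X⟦n⟧) :=
  ((closedUnderCoprodExt_coprod (shiftsIn G ((· + n) ⁻¹' I))).shift n).coprod_le
    (fun _ h => .base _ (shiftsIn_shift G I n h)) _ hX

lemma bigGen_shift (G : C) (I : Set ℤ) (n : ℤ) {X : C} (hX : bigGen G I X) :
    bigGen G ((· + n) ⁻¹' I) (X⟦n⟧) := by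
  obtain ⟨Y, hY, ⟨r⟩⟩ := hX
  exact ⟨_, coprod_shift G I n hY, ⟨r.map (shiftFunctor C n)⟩⟩

omit [HasZeroObject C] [Preadditive C] [∀ n : ℤ, (shiftFunctor C n).Additive]
  [Pretriangulated C] [HasCoproducts.{v} C] in
lemma shiftsIn_mono (G : C) {I J : Set ℤ} (h : I ⊆ J) : shiftsIn G I ≤ shiftsIn G J :=
  fun _ ⟨i, hi, e⟩ => ⟨i, h hi, e⟩

lemma coprod_mono {P Q : ObjectProperty C} (h : P ≤ Q) : Coprod P ≤ Coprod Q :=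
  (closedUnderCoprodExt_coprod Q).coprod_le fun _ hX => .base _ (h _ hX)

lemma bigGen_mono (G : C) {I J : Set ℤ} (h : I ⊆ J) : bigGen G I ≤ bigGen G J :=
  ObjectProperty.monotone_retractClosure (coprod_mono (shiftsIn_mono G h))

/-- The class generated by the `G[-i]`, `i ≤ n`, is closed under direct summands. -/
lemma coprod_Iic_of_retract (G : C) (n : ℤ) {X Z : C} (r : Retract X Z)
    (hZ : Coprod (shiftsIn G (Set.Iic n)) Z) : Coprod (shiftsIn G (Set.Iic n)) X :=
  (closedUnderCoprodExt_coprod _).of_retract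
    (fun _ h => coprod_mono (shiftsIn_mono G (fun i hi => by
      simp only [Set.mem_preimage, Set.mem_Iic] at hi ⊢; lia)) _ (coprod_shift G _ 1 h)) r hZ

/-- The half-line `(-∞, n]` is stable under `[1]`, so the swindle makes summands automatic. Aisles
can therefore be handled as instances of `bigGen`. -/
lemma bigGen_Iic_eq (G : C) (n : ℤ) :
    bigGen G (Set.Iic n) = Coprod (shiftsIn G (Set.Iic n)) :=
  le_antisymm (fun _ ⟨_, hZ, ⟨r⟩⟩ => coprod_Iic_of_retract G n r hZ) (coprod_le_bigGen G _)

/-- The induction principle for `bigGen`. -/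
lemma bigGen_le {G : C} {I : Set ℤ} {Q : ObjectProperty C} (hQ : ClosedUnderCoprodExt Q)
    (hr : ∀ {X Y : C}, Retract X Y → Q Y → Q X) (h : ∀ i ∈ I, Q (G⟦-i⟧)) : bigGen G I ≤ Q :=
  fun _ ⟨_, hY, ⟨r⟩⟩ => hr r (hQ.coprod_le
    (fun _ ⟨i, hi, ⟨e⟩⟩ => hQ.of_iso e.symm (h i hi)) _ hY)

lemma bigGen_of_shift (G : C) (I : Set ℤ) (n : ℤ) {X : C} (hX : bigGen G I (X⟦n⟧)) :
    bigGen G ((· - n) ⁻¹' I) X :=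
  (closedUnderCoprodExt_bigGen _ _).of_iso ((shiftShiftNeg X n))
    (bigGen_shift G I (-n) hX)

lemma genLE_iff (G : C) (n : ℤ) (X : C) :
    genLE G n X ↔ bigGen G (Set.Iic n) X := by
  rw [genLE, ObjectProperty.prop_shift_iff, ← bigGen_Iic_eq]
  constructor
  · intro h
    refine bigGen_mono G (fun i hi => ?_) _ (bigGen_of_shift G _ n h)
    simp only [Set.mem_preimage, Set.mem_Iic] at hi ⊢; lia
  · intro h
    refine bigGen_mono G (fun i hi => ?_) _ (bigGen_shift G _ n h)
    simp only [Set.mem_preimage, Set.mem_Iic] at hi ⊢; lia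

/-- If `G ∈ bigGen G' I`, then `bigGen G J` is contained in `bigGen G' (I + J)`. -/
lemma bigGen_le_bigGen {G G' : C} {I J K : Set ℤ} (hG : bigGen G' I G)
    (h : ∀ i ∈ I, ∀ j ∈ J, i + j ∈ K) : bigGen G J ≤ bigGen G' K :=
  bigGen_le (closedUnderCoprodExt_bigGen _ _)
    (fun r ⟨Z, hZ, ⟨r'⟩⟩ => ⟨Z, hZ, ⟨r.trans r'⟩⟩)
    (fun j hj => bigGen_mono G' (fun i hi => by
      have := h (i + -j) hi j hj
      simpa using this) _ (bigGen_shift G' I (-j) hG))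

end ClosureProperties

/-! ### Compact objects: factorizations and orthogonals -/

section CompactFactorization

variable {C : Type u} [Category.{v} C] [Preadditive C] [HasCoproducts.{v} C]

/-- A morphism from a compact object to a coproduct is a finite sum of morphisms through single
summands. -/
lemma IsCompactObject.induction_hom {X : C} (hX : IsCompactObject X) {J : Type v} (Y : J → C)
    (R : (X ⟶ ∐ Y) → Prop) (h0 : R 0) (hadd : ∀ a b, R a → R b → R (a + b))
    (hι : ∀ (j : J) (a : X ⟶ Y j), R (a ≫ Sigma.ι Y j)) (f : X ⟶ ∐ Y) : R f := by
  classical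
  obtain ⟨s, hs⟩ := (isCompactObject_iff X).1 hX J Y f
  rw [← hs, finProj, Preadditive.comp_sum]
  refine Finset.sum_induction _ R hadd h0 fun j _ => ?_
  rw [← Category.assoc]
  exact hι _ _

lemma IsCompactObject.hom_ext {X : C} (hX : IsCompactObject X) {J : Type v} [DecidableEq J]
    (Y : J → C)
    (f : X ⟶ ∐ Y) (h : ∀ j, f ≫ Sigma.π Y j = 0) : f = 0 := by
  obtain rfl : ‹DecidableEq J› = fun a b => Classical.propDecidable (a = b) :=
    Subsingleton.elim _ _
  obtain ⟨s, hs⟩ := (isCompactObject_iff X).1 hX J Y f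
  rw [← hs, finProj, Preadditive.comp_sum]
  exact Finset.sum_eq_zero fun j _ => by rw [← Category.assoc, h, zero_comp]

variable [HasZeroObject C] [HasShift C ℤ]
  [∀ n : ℤ, (shiftFunctor C n).Additive] [Pretriangulated C]

omit [HasZeroObject C] [Pretriangulated C] in
lemma IsCompactObject.shift {X : C} (hX : IsCompactObject X) (n : ℤ) :
    IsCompactObject (X⟦n⟧) :=
  ObjectProperty.le_shift (P := IsCompactObject) n _ hX

/-- A morphism from a compact object to an object built from `P` by coproducts and extensions
factors through an object built from `P` by finitely many extensions. -/
lemma exists_factorization {P Q : ObjectProperty C} (hP : P ≤ Q) (hQ : Q ≤ IsCompactObject)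
    (h0 : Q 0) (hext : ∀ T ∈ distTriang C, Q T.obj₁ → Q T.obj₃ → Q T.obj₂)
    {X Y : C} (hX : IsCompactObject X) (f : X ⟶ Y) (hY : Coprod P Y) :
    ∃ (E : C) (_ : Q E) (a : X ⟶ E) (b : E ⟶ Y), a ≫ b = f := by
  induction hY generalizing X with
  | base Y hY => exact ⟨Y, hP _ hY, f, 𝟙 Y, Category.comp_id f⟩
  | coprod Y _ ih =>
    refine hX.induction_hom Y (fun f => ∃ (E : C) (_ : Q E) (a : X ⟶ E) (b : E ⟶ _), a ≫ b = f)
      ⟨0, h0, 0, 0, comp_zero⟩ ?_ ?_ f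
    · rintro _ _ ⟨E, hE, a, b, rfl⟩ ⟨E', hE', a', b', rfl⟩
      exact ⟨E ⊞ E', hext _ (binaryBiproductTriangle_distinguished E E') hE hE',
        biprod.lift a a', biprod.desc b b', biprod.lift_desc⟩
    · intro j g
      obtain ⟨E, hE, a, b, rfl⟩ := ih j hX g
      exact ⟨E, hE, a, b ≫ Sigma.ι Y j, by rw [Category.assoc]⟩
  | ext T hT _ _ ih₁ ih₃ =>
    obtain ⟨E₃, hE₃, a₃, b₃, h₃⟩ := ih₃ hX (f ≫ T.mor₂)
    -- The fibre `X'` of `a₃` is compact, and `f` restricted to it lifts to `T.obj₁`, where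
    -- induction applies again.
    obtain ⟨X', i, δ, hT'⟩ := distinguished_cocone_triangle₁ a₃
    have hX' : IsCompactObject X' :=
      ObjectProperty.ext_of_isTriangulatedClosed₁ IsCompactObject _ hT' hX (hQ _ hE₃)
    have hi : i ≫ a₃ = 0 := comp_distTriang_mor_zero₁₂ _ hT'
    obtain ⟨g, hg⟩ := Triangle.coyoneda_exact₂ T hT (i ≫ f)
      (by rw [Category.assoc, ← h₃, reassoc_of% hi, zero_comp])
    obtain ⟨E₁, hE₁, a₁, b₁, rfl⟩ := ih₁ hX' g
    -- The map `b₃` need not respect the connecting morphisms; `c` replaces it.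
    obtain ⟨(c : E₃ ⟶ T.obj₃), (hc₁ : a₃ ≫ c = f ≫ T.mor₂),
      (hc₂ : δ ≫ (a₁ ≫ b₁)⟦(1 : ℤ)⟧' = c ≫ T.mor₃)⟩ :=
      complete_distinguished_triangle_morphism _ T hT' hT (a₁ ≫ b₁) f hg
    rw [Functor.map_comp] at hc₂
    obtain ⟨E, j, w, hE⟩ := distinguished_cocone_triangle₂ (δ ≫ a₁⟦(1 : ℤ)⟧')
    obtain ⟨(p : X ⟶ E), (hp₁ : i ≫ p = a₁ ≫ j), (hp₂ : a₃ ≫ 𝟙 E₃ = p ≫ w)⟩ :=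
      complete_distinguished_triangle_morphism₂ _ _ hT' hE a₁ (𝟙 E₃) (Category.id_comp _).symm
    obtain ⟨(q : E ⟶ T.obj₂), (hq₁ : j ≫ q = b₁ ≫ T.mor₁), (hq₂ : w ≫ c = q ≫ T.mor₂)⟩ :=
      complete_distinguished_triangle_morphism₂ _ _ hE hT b₁ c ((Category.assoc _ _ _).trans hc₂)
    rw [Category.comp_id] at hp₂
    -- The composite `p ≫ q` may differ from `f`, but the difference vanishes on `X'`, so it factors
    -- through `a₃ = p ≫ w` and is absorbed by correcting `q`.
    obtain ⟨(h : E₃ ⟶ T.obj₂), (hh : p ≫ q - f = a₃ ≫ h)⟩ :=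
      Triangle.yoneda_exact₂ _ hT' (p ≫ q - f) (by
        change i ≫ (p ≫ q - f) = 0
        rw [Preadditive.comp_sub, reassoc_of% hp₁, hq₁, hg, Category.assoc, sub_self])
    refine ⟨E, hext _ hE hE₁ hE₃, p, q - w ≫ h, ?_⟩
    rw [Preadditive.comp_sub, ← Category.assoc, ← hp₂, ← hh, sub_sub_cancel]

/-- A compact object which is a direct summand of an object built from `P` by coproducts
and extensions is a direct summand of an object built from `P` by finitely many extensions. -/
lemma exists_retract {P Q : ObjectProperty C} (hP : P ≤ Q) (hQ : Q ≤ IsCompactObject)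
    (h0 : Q 0) (hext : ∀ T ∈ distTriang C, Q T.obj₁ → Q T.obj₃ → Q T.obj₂)
    {X : C} (hX : IsCompactObject X) (h : ObjectProperty.retractClosure (Coprod P) X) :
    Q.retractClosure X := by
  obtain ⟨Y, hY, ⟨r⟩⟩ := h
  obtain ⟨E, hE, a, b, hab⟩ := exists_factorization hP hQ h0 hext hX r.i hY
  exact ⟨E, hE, ⟨⟨a, b ≫ r.r, by rw [reassoc_of% hab, r.retract]⟩⟩⟩

omit [HasZeroObject C] [Pretriangulated C] in
lemma isCompactObject_of_mem_shiftsIn {G : C} (hG : IsCompactObject G)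
    (I : Set ℤ) : shiftsIn G I ≤ IsCompactObject :=
  fun _ ⟨i, _, ⟨e⟩⟩ => ObjectProperty.prop_of_iso IsCompactObject e.symm (hG.shift (-i))

/-- A compact object generated by all the shifts of `G` is generated by finitely many of them. -/
lemma IsCompactObject.exists_bigGen_Icc {G X : C} (hG : IsCompactObject G)
    (hX : IsCompactObject X) (h : bigGen G Set.univ X) :
    ∃ N : ℕ, bigGen G (Set.Icc (-N : ℤ) N) X := by
  have hmono : ∀ {m n : ℕ}, m ≤ n → ∀ {Y : C}, Coprod (shiftsIn G (Set.Icc (-m : ℤ) m)) Y →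
      Coprod (shiftsIn G (Set.Icc (-n : ℤ) n)) Y := fun hmn Y hY =>
    coprod_mono (shiftsIn_mono G (Set.Icc_subset_Icc (by lia) (by lia))) _ hY
  obtain ⟨E, ⟨_, N, hE⟩, r⟩ := exists_retract (P := shiftsIn G Set.univ)
    (Q := fun E => IsCompactObject E ∧ ∃ N : ℕ, Coprod (shiftsIn G (Set.Icc (-N : ℤ) N)) E)
    (fun Y hY => ⟨isCompactObject_of_mem_shiftsIn hG _ _ hY, by
      obtain ⟨i, _, e⟩ := hY
      exact ⟨i.natAbs, .base _ ⟨i, by simp only [Set.mem_Icc]; lia, e⟩⟩⟩)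
    (fun _ h => h.1)
    ⟨ObjectProperty.prop_zero _, 0, (closedUnderCoprodExt_coprod _).of_isZero (isZero_zero C)⟩
    (fun T hT h₁ h₃ => ⟨ObjectProperty.ext_of_isTriangulatedClosed₂ _ T hT h₁.1 h₃.1, by
      obtain ⟨_, m, hm⟩ := h₁
      obtain ⟨_, n, hn⟩ := h₃
      exact ⟨max m n, .ext T hT (hmono (le_max_left _ _) hm) (hmono (le_max_right _ _) hn)⟩⟩)
    hX h
  exact ⟨N, E, hE, r⟩

lemma closedUnderCoprodExt_leftOrthogonal (P : ObjectProperty C) :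
    ClosedUnderCoprodExt P.leftOrthogonal where
  coprod Y hY Z f hZ := Sigma.hom_ext _ _ fun j => by rw [hY j (Sigma.ι Y j ≫ f) hZ, comp_zero]
  ext T hT h₁ h₃ Z f hZ := by
    obtain ⟨g, rfl⟩ := Triangle.yoneda_exact₂ T hT f (h₁ _ hZ)
    rw [h₃ g hZ, comp_zero]

lemma closedUnderCoprodExt_rightOrthogonal {P : ObjectProperty C} (hP : P ≤ IsCompactObject) :
    ClosedUnderCoprodExt P.rightOrthogonal where
  coprod Y hY X f hX := by
    classical
    exact (hP _ hX).hom_ext Y f fun j => hY j _ hX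
  ext T hT h₁ h₃ Z f hZ := by
    obtain ⟨g, rfl⟩ := Triangle.coyoneda_exact₂ T hT f (h₃ _ hZ)
    rw [h₁ g hZ, zero_comp]

omit [Preadditive C] [HasCoproducts.{v} C] [HasShift C ℤ] [HasZeroObject C]
  [∀ n : ℤ, (shiftFunctor C n).Additive] [Pretriangulated C] in
lemma leftOrthogonal_of_retract [HasZeroMorphisms C] {P : ObjectProperty C} {X Y : C}
    (r : Retract X Y) (hY : P.leftOrthogonal Y) : P.leftOrthogonal X := fun Z f hZ => by
  rw [← Category.id_comp f, ← r.retract, Category.assoc, hY (r.r ≫ f) hZ, comp_zero]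

omit [Preadditive C] [HasCoproducts.{v} C] [HasShift C ℤ] [HasZeroObject C]
  [∀ n : ℤ, (shiftFunctor C n).Additive] [Pretriangulated C] in
lemma rightOrthogonal_of_retract [HasZeroMorphisms C] {P : ObjectProperty C} {X Y : C}
    (r : Retract X Y) (hY : P.rightOrthogonal Y) : P.rightOrthogonal X := fun Z f hZ => by
  rw [← Category.comp_id f, ← r.retract, ← Category.assoc, hY (f ≫ r.i) hZ, zero_comp]

/-- The objects without nonzero maps to `K` are closed under all building operations and contain the
shifts of `G`, hence `K` itself. -/
lemma IsCompactGenerator.isZero {G K : C} (hG : IsCompactGenerator G)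
    (h : ∀ (i : ℤ) (f : G⟦i⟧ ⟶ K), f = 0) : IsZero K := by
  have := bigGen_le (closedUnderCoprodExt_leftOrthogonal (ObjectProperty.singleton K))
    leftOrthogonal_of_retract (fun i _ Y f hY => by
      obtain rfl : K = Y := by simpa using hY
      exact h _ f) _ (hG.2 K)
  exact (IsZero.iff_id_eq_zero K).2 (this (𝟙 K) (by simp))

end CompactFactorization

/-! ### Homotopy colimits tested by a compact generator -/

section Telescope

variable {C : Type u} [Category.{v} C] [Preadditive C] [HasZeroObject C] [HasShift C ℤ]
  [∀ n : ℤ, (shiftFunctor C n).Additive] [Pretriangulated C]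

/-- Long exact sequence: `y ≫ T.mor₃` is, up to `e`, the shift of a map killed by `T.mor₁`. So every
map from `P` to the cone lifts to `T.obj₂`. -/
lemma comp_mor₃_eq_zero {T : Triangle C} (hT : T ∈ distTriang C) {P P' : C}
    (e : P'⟦(1 : ℤ)⟧ ≅ P) (h : ∀ z : P' ⟶ T.obj₁, z ≫ T.mor₁ = 0 → z = 0)
    (y : P ⟶ T.obj₃) : y ≫ T.mor₃ = 0 := by
  obtain ⟨z, hz⟩ := (shiftFunctor C (1 : ℤ)).map_surjective (e.hom ≫ y ≫ T.mor₃)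
  have hz' : z = 0 := h z ((shiftFunctor C (1 : ℤ)).map_injective (by
    rw [Functor.map_comp, hz, Functor.map_zero, Category.assoc, Category.assoc,
      comp_distTriang_mor_zero₃₁ T hT, comp_zero, comp_zero]))
  rw [hz', Functor.map_zero] at hz
  rw [← cancel_epi e.hom, ← hz, comp_zero]

variable [HasCoproducts.{v} C]

/-- An object which is the homotopy colimit of a sequence of objects of `Q`, as tested by a
compact generator, belongs to `Q`. -/
lemma ClosedUnderCoprodExt.of_sequence {G : C} (hG : IsCompactGenerator G)
    {Q : ObjectProperty C} (hQ : ClosedUnderCoprodExt Q) (hs : Q ≤ Q.shift (1 : ℤ)) {F : C}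
    (E : ℕ → C) (f : ∀ n, E n ⟶ E (n + 1)) (g : ∀ n, E n ⟶ F)
    (hfg : ∀ n, f n ≫ g (n + 1) = g n) (hE : ∀ n, Q (E n))
    (hsurj : ∀ i : ℤ, ∃ m₀ : ℕ, ∀ m ≥ m₀, ∀ x : G⟦i⟧ ⟶ F, ∃ y, y ≫ g m = x)
    (hinj : ∀ i : ℤ, ∃ m₀ : ℕ, ∀ m ≥ m₀, ∀ y : G⟦i⟧ ⟶ E m, y ≫ g m = 0 → y = 0) : Q F := by
  have hGc : ∀ i : ℤ, IsCompactObject (G⟦i⟧) := fun i => hG.1.shift i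
  have e : ∀ i : ℤ, (G⟦i - 1⟧)⟦(1 : ℤ)⟧ ≅ G⟦i⟧ := fun i =>
    ((shiftFunctorAdd' C (i - 1) 1 i (by lia)).app G).symm
  let Y : ULift.{v} ℕ → C := fun j => E j.down
  let ι : ∀ n, E n ⟶ ∐ Y := fun n => Sigma.ι Y ⟨n⟩
  let π : ∀ n, ∐ Y ⟶ E n := fun n => Sigma.π Y ⟨n⟩
  let σ : ∐ Y ⟶ ∐ Y := Sigma.desc fun j => f j.down ≫ ι (j.down + 1)
  have hσ : ∀ n, ι n ≫ σ = f n ≫ ι (n + 1) := fun n => Sigma.ι_desc _ _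
  let γ : ∐ Y ⟶ F := Sigma.desc fun j => g j.down
  have hγ : ∀ n, ι n ≫ γ = g n := fun n => Sigma.ι_desc _ _
  have hext {B : C} (f g : ∐ Y ⟶ B) (h : ∀ n, ι n ≫ f = ι n ≫ g) : f = g :=
    Sigma.hom_ext _ _ fun j => h j.down
  have hιπ : ∀ n, ι n ≫ π n = 𝟙 _ := fun n => Sigma.ι_π_eq_id Y _
  have hιπ' : ∀ m n, m ≠ n → ι m ≫ π n = 0 := fun m n h =>
    Sigma.ι_π_of_ne Y (fun h' => h (congrArg ULift.down h'))
  have hσπ0 : σ ≫ π 0 = 0 := hext _ _ fun n => by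
    rw [reassoc_of% hσ, hιπ' _ _ (by lia), comp_zero, comp_zero]
  have hσπ : ∀ k, σ ≫ π (k + 1) = π k ≫ f k := fun k => hext _ _ fun n => by
    rw [reassoc_of% hσ]
    by_cases h : n = k
    · subst h
      rw [hιπ, reassoc_of% hιπ, Category.comp_id]
    · rw [hιπ' _ _ (by lia), reassoc_of% (hιπ' n k h), zero_comp, comp_zero]
  -- `T` is the homotopy colimit of the `E n`; the rest shows that the induced map `h : T ⟶ F` is an
  -- isomorphism.
  obtain ⟨T, t, w, hT⟩ := distinguished_cocone_triangle (𝟙 _ - σ)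
  have hdt : (𝟙 _ - σ) ≫ t = 0 := comp_distTriang_mor_zero₁₂ _ hT
  have hιt : ∀ n, ι n ≫ t = f n ≫ ι (n + 1) ≫ t := fun n => by
    have := ι n ≫= hdt
    rw [Preadditive.sub_comp, Category.id_comp, comp_zero, Preadditive.comp_sub,
      reassoc_of% hσ] at this
    exact sub_eq_zero.1 this
  obtain ⟨(h : T ⟶ F), (hh : γ = t ≫ h)⟩ := Triangle.yoneda_exact₂ _ hT γ (hext _ _ fun n => by
    change ι n ≫ (𝟙 _ - σ) ≫ γ = ι n ≫ 0
    rw [Preadditive.sub_comp, Category.id_comp, Preadditive.comp_sub, reassoc_of% hσ, hγ, hγ,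
      hfg, sub_self, comp_zero])
  have hιth : ∀ n, ι n ≫ t ≫ h = g n := fun n => by rw [← hh, hγ]
  -- A map fixed by `σ` has zero component in place `0`, hence inductively in every place.
  have inj₁ : ∀ (i : ℤ) (z : G⟦i⟧ ⟶ ∐ Y), z ≫ (𝟙 _ - σ) = 0 → z = 0 := by
    intro i z hz
    rw [Preadditive.comp_sub, Category.comp_id, sub_eq_zero] at hz
    have : ∀ n, z ≫ π n = 0 := by
      intro n
      induction n with
      | zero => rw [hz, Category.assoc, hσπ0, comp_zero]
      | succ n ih => rw [hz, Category.assoc, hσπ, reassoc_of% ih, zero_comp]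
    exact (hGc i).hom_ext Y z fun j => this j.down
  have lift₁ : ∀ (i : ℤ) (z : G⟦i⟧ ⟶ ∐ Y), ∃ m₀ : ℕ, ∀ m ≥ m₀, ∃ a : G⟦i⟧ ⟶ E m,
      z ≫ t = a ≫ ι m ≫ t := by
    intro i
    refine (hGc i).induction_hom Y (fun z => ∃ m₀ : ℕ, ∀ m ≥ m₀, ∃ a : G⟦i⟧ ⟶ E m,
      z ≫ t = a ≫ ι m ≫ t) ⟨0, fun m _ => ⟨0, by simp⟩⟩ ?_ ?_
    · rintro x y ⟨m, hm⟩ ⟨n, hn⟩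
      refine ⟨max m n, fun k hk => ?_⟩
      obtain ⟨a, ha⟩ := hm k ((le_max_left _ _).trans hk)
      obtain ⟨b, hb⟩ := hn k ((le_max_right _ _).trans hk)
      exact ⟨a + b, by rw [Preadditive.add_comp, ha, hb, Preadditive.add_comp]⟩
    · rintro ⟨n⟩ a
      refine ⟨n, fun m hm => ?_⟩
      induction m, hm using Nat.le_induction with
      | base => exact ⟨a, Category.assoc _ _ _⟩
      | succ m _ ih =>
        obtain ⟨b, hb⟩ := ih
        exact ⟨b ≫ f m, by rw [hb, hιt m, Category.assoc]⟩
  have lift₂ : ∀ (i : ℤ) (y : G⟦i⟧ ⟶ T), ∃ m₀ : ℕ, ∀ m ≥ m₀, ∃ a : G⟦i⟧ ⟶ E m,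
      y = a ≫ ι m ≫ t := by
    intro i y
    obtain ⟨z, rfl⟩ := Triangle.coyoneda_exact₃ _ hT y
      (comp_mor₃_eq_zero hT (e i) (inj₁ (i - 1)) y)
    exact lift₁ i z
  have inj₂ : ∀ (i : ℤ) (y : G⟦i⟧ ⟶ T), y ≫ h = 0 → y = 0 := by
    intro i y hy
    obtain ⟨m, hm⟩ := lift₂ i y
    obtain ⟨n, hn⟩ := hinj i
    obtain ⟨a, rfl⟩ := hm (max m n) (le_max_left _ _)
    rw [hn _ (le_max_right _ _) a (by simpa only [Category.assoc, hιth] using hy), zero_comp]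
  obtain ⟨K, p, q, hK⟩ := distinguished_cocone_triangle h
  -- Injectivity of `h` lifts `k` to `F`; there it comes from some `E m`, hence from `T`, and so
  -- dies in `K`.
  have hK0 : IsZero K := hG.isZero fun i k => by
    obtain ⟨x, rfl⟩ := Triangle.coyoneda_exact₃ _ hK k
      (comp_mor₃_eq_zero hK (e i) (inj₂ (i - 1)) k)
    obtain ⟨m, hm⟩ := hsurj i
    obtain ⟨y, rfl⟩ := hm m le_rfl x
    have : h ≫ p = 0 := comp_distTriang_mor_zero₁₂ _ hK
    change (y ≫ g m) ≫ p = 0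
    rw [← hιth m, Category.assoc, Category.assoc, Category.assoc, this, comp_zero, comp_zero,
      comp_zero]
  have : IsIso h := (Triangle.isZero₃_iff_isIso₁ _ hK).1 hK0
  have hY : Q (∐ Y) := hQ.coprod Y fun j => hE j.down
  -- `T` is an extension of `(∐ Y)[1]` by `∐ Y`.
  exact hQ.of_iso (asIso h) (hQ.ext _ (rot_of_distTriang _ hT) hY (hs _ hY))

end Telescope

/-! ### Approximability of the generated t-structure -/

section Approximation

variable {C : Type u} [Category.{v} C] [Preadditive C] [HasZeroObject C] [HasShift C ℤ]
  [∀ n : ℤ, (shiftFunctor C n).Additive] [Pretriangulated C]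

lemma extensionProduct_of_shift {P Q P' Q' : ObjectProperty C} (n : ℤ)
    (hP : ∀ Y, P Y → P' (Y⟦-n⟧)) (hQ : ∀ Y, Q Y → Q' (Y⟦-n⟧)) {X : C}
    (h : ObjectProperty.extensionProduct P Q (X⟦n⟧)) :
    ObjectProperty.extensionProduct P' Q' X := by
  obtain ⟨Y, Z, f, g, k, hT, hY, hZ⟩ := h
  exact ObjectProperty.prop_of_iso _ (shiftShiftNeg X n)
    ⟨_, _, _, _, _, Triangle.shift_distinguished _ hT (-n), hP _ hY, hQ _ hZ⟩

variable [HasCoproducts.{v} C]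

/-- Iterating approximations. -/
lemma le_extensionProduct_iterate [IsTriangulated C] (L : ℤ → ObjectProperty C) {G : C} {a : ℤ}
    (hL : ∀ n, L n ≤ ObjectProperty.extensionProduct
      (bigGen G (Set.Icc (n - a) (n + a))) (L (n - 1))) (n : ℤ) (k : ℕ) :
    L n ≤ ObjectProperty.extensionProduct
      (bigGen G (Set.Icc (n - k + 1 - a) (n + a))) (L (n - k)) := by
  induction k with
  | zero =>
    intro X hX
    exact ⟨_, X, _, _, _, contractible_distinguished₁ X,
      (closedUnderCoprodExt_bigGen _ _).of_isZero (isZero_zero C), by simpa using hX⟩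
  | succ k ih =>
    -- The new step contributes the interval `[n-k-a, n-k+a]`, so only the lower end of the total
    -- interval moves.
    refine (ih.trans (ObjectProperty.monotone_extensionProduct_right _ (hL (n - k)))).trans ?_
    rw [← ObjectProperty.extensionProduct_assoc,
      show n - ((k + 1 : ℕ) : ℤ) = n - k - 1 by push_cast; ring]
    refine ObjectProperty.monotone_extensionProduct_left _
      ((closedUnderCoprodExt_bigGen G _).extensionProduct_le
        (bigGen_mono G ?_) (bigGen_mono G ?_)) <;>
    exact Set.Icc_subset_Icc (by lia) (by lia)

/-- An aisle is the left orthogonal of its coaisle. -/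
lemma closedUnderCoprodExt_tStructure_le (t : TStructure C) (n : ℤ) :
    ClosedUnderCoprodExt (t.le n) ∧ ∀ {X Y : C}, Retract X Y → t.le n Y → t.le n X := by
  have : t.le n = (t.ge (n + 1)).leftOrthogonal := by
    ext X
    rw [t.le_iff_isLE, t.isLE_iff_orthogonal n (n + 1) rfl]
    exact ⟨fun h Y f hY => h Y f ⟨hY⟩, fun h Y f hY => h f hY.ge⟩
  rw [this]
  exact ⟨closedUnderCoprodExt_leftOrthogonal _, leftOrthogonal_of_retract⟩

/-- The condition of approximability of a t-structure by an object, at the constant `A`. -/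
structure IsApproximatedBy (t : TStructure C) (G : C) (A : ℤ) : Prop where
  le : t.le 0 (G⟦A⟧)
  hom_eq_zero : ∀ Y : C, t.le 0 Y → ∀ f : G⟦-A⟧ ⟶ Y, f = 0
  approx : ∀ F : C, t.le 0 F →
    ObjectProperty.extensionProduct (bigGen G (Set.Icc (-A) A)) (t.le (-1)) F

namespace IsApproximatedBy

variable {t : TStructure C} {G : C} {A : ℤ} (h : IsApproximatedBy t G A)
include h

lemma hom_eq_zero' {i n : ℤ} (hin : n + i + A ≤ 0) {Y : C} (hY : t.le n Y) (f : G⟦i⟧ ⟶ Y) :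
    f = 0 := by
  let e : G⟦-A⟧ ≅ (G⟦i⟧)⟦-A - i⟧ := (shiftFunctorAdd' C i (-A - i) (-A) (by lia)).app G
  refine (shiftFunctor C (-A - i)).map_injective ?_
  rw [Functor.map_zero, ← cancel_epi e.hom, comp_zero]
  refine h.hom_eq_zero _ (t.le_monotone (show n + i + A ≤ 0 by lia) _
    (t.le_shift n (-A - i) _ (by lia) _ hY)) _

lemma le_extensionProduct (n : ℤ) : t.le n ≤ ObjectProperty.extensionProduct
    (bigGen G (Set.Icc (n - A) (n + A))) (t.le (n - 1)) := by
  intro F hF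
  refine extensionProduct_of_shift n (fun Y hY => ?_) (fun Y hY => ?_)
    (h.approx _ (t.le_shift n n 0 (by lia) F hF))
  · refine bigGen_mono _ (fun i hi => ?_) _ (bigGen_shift _ _ (-n) hY)
    simp only [Set.mem_preimage, Set.mem_Icc] at hi ⊢
    lia
  · exact t.le_shift _ _ _ (by lia) _ hY

/-- Successive approximations of `F`. -/
structure Stage (t : TStructure C) (G : C) (A : ℤ) (F : C) (n : ℕ) where
  /-- the approximation -/
  E : C
  /-- the error term -/
  D : C
  /-- the first morphism of the triangle -/
  e : E ⟶ F
  /-- the second morphism of the triangle -/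
  d : F ⟶ D
  /-- the third morphism of the triangle -/
  δ : D ⟶ E⟦(1 : ℤ)⟧
  dist : Triangle.mk e d δ ∈ distTriang C
  hE : bigGen G (Set.Iic A) E
  hD : t.le (-n) D

/-- Approximate the error term. By the octahedral axiom the new approximation of `F` is an extension
of `E'` by the old one, and `E'` only involves degrees at most `A`. -/
lemma exists_next [IsTriangulated C] {F : C} {n : ℕ} (s : Stage t G A F n) :
    ∃ (s' : Stage t G A F (n + 1)) (p : s.D ⟶ s'.D), s.d ≫ p = s'.d := by
  obtain ⟨E', D', i, p, δ, hT, hE', hD'⟩ := h.le_extensionProduct _ _ s.hD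
  obtain ⟨E, e, δ', hE⟩ := distinguished_cocone_triangle₁ (s.d ≫ p)
  refine ⟨⟨E, D', e, _, δ', hE, ?_, ?_⟩, p, rfl⟩
  · exact (closedUnderCoprodExt_bigGen _ _).ext _ (someOctahedron' rfl s.dist hT hE).mem s.hE
      (bigGen_mono _ (fun i hi => by simp only [Set.mem_Icc, Set.mem_Iic] at hi ⊢; lia) _ hE')
  · rwa [Nat.cast_succ, neg_add]

/-- The error terms sink below every degree, so each `G[i]` eventually cannot distinguish the
approximations from `F`, which is thus their homotopy colimit. -/
lemma le_zero_le [IsTriangulated C] (hG : IsCompactGenerator G) :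
    t.le 0 ≤ bigGen G (Set.Iic A) := by
  intro F hF
  choose next p hp using fun (n : ℕ) (s : Stage t G A F n) => h.exists_next s
  let s : ∀ n : ℕ, Stage t G A F n := fun n => Nat.rec
    ⟨_, F, _, _, _, contractible_distinguished₁ F,
      (closedUnderCoprodExt_bigGen _ _).of_isZero (isZero_zero C), by simpa using hF⟩
    (fun n s => next n s) n
  have hs : ∀ n, (s n).d ≫ p n (s n) = (s (n + 1)).d := fun n => hp n (s n)
  have hf : ∀ n, ∃ f : (s n).E ⟶ (s (n + 1)).E, f ≫ (s (n + 1)).e = (s n).e := fun n => by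
    obtain ⟨f, hf, -⟩ := complete_distinguished_triangle_morphism₁ _ _ (s n).dist (s (n + 1)).dist
      (𝟙 F) (p n (s n)) ((hs n).trans (Category.id_comp _).symm)
    exact ⟨f, hf.symm.trans (Category.comp_id _)⟩
  choose f hf using hf
  refine (closedUnderCoprodExt_bigGen G (Set.Iic A)).of_sequence hG (fun X hX => ?_)
    (fun n => (s n).E) f (fun n => (s n).e) hf (fun n => (s n).hE) (fun i => ?_) (fun i => ?_)
  · refine bigGen_mono _ (fun i hi => ?_) _ (bigGen_shift G _ 1 hX)
    simp only [Set.mem_preimage, Set.mem_Iic] at hi ⊢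
    lia
  · refine ⟨(A + i).toNat, fun m hm x => ?_⟩
    obtain ⟨y, hy⟩ := Triangle.coyoneda_exact₂ _ (s m).dist x
      (h.hom_eq_zero' (by lia) (s m).hD _)
    exact ⟨y, hy.symm⟩
  -- One stage later than for surjectivity: the kernel comes from `D[-1]`, which lies one degree
  -- higher than `D`.
  · refine ⟨(A + i + 1).toNat, fun m hm y hy => ?_⟩
    obtain ⟨z, rfl⟩ := Triangle.coyoneda_exact₂ _ (inv_rot_of_distTriang _ (s m).dist) y hy
    have hz : z = 0 := h.hom_eq_zero' (n := -m + 1) (by lia)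
      (t.le_shift (-m) (-1) _ (by lia) _ (s m).hD) z
    rw [hz, zero_comp]
    rfl

lemma le_le_bigGen [IsTriangulated C] (hG : IsCompactGenerator G) (n : ℤ) :
    t.le n ≤ bigGen G (Set.Iic (n + A)) := by
  intro F hF
  refine bigGen_mono _ (fun i hi => ?_) _
    (bigGen_of_shift _ _ n (h.le_zero_le hG _ (t.le_shift n n 0 (by lia) F hF)))
  simp only [Set.mem_preimage, Set.mem_Iic] at hi ⊢
  lia

lemma bigGen_Iic_le (n : ℤ) : bigGen G (Set.Iic n) ≤ t.le (n + A) := by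
  obtain ⟨h₁, h₂⟩ := closedUnderCoprodExt_tStructure_le t (n + A)
  refine bigGen_le h₁ h₂ fun i hi => ?_
  have : t.le (i + A) (G⟦-i⟧) := ObjectProperty.prop_of_iso _
    ((shiftFunctorAdd' C A (-i - A) (-i) (by lia)).app G).symm
    (t.le_shift 0 (-i - A) _ (by lia) _ h.le)
  exact t.le_monotone (by simp only [Set.mem_Iic] at hi; lia) _ this

end IsApproximatedBy

lemma exists_bigGen_Icc {G G' : C} (hG : IsCompactGenerator G) (hG' : IsCompactGenerator G') :
    ∃ N : ℕ, bigGen G (Set.Icc (-N : ℤ) N) G' :=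
  hG.1.exists_bigGen_Icc hG'.1 (hG.2 G')

/-- In a weakly approximable category the t-structure generated by a compact generator is
approximated by the generator. -/
lemma exists_forall_genLE [IsTriangulated C] (hC : IsWeaklyApproximable C) {G : C}
    (hG : IsCompactGenerator G) : ∃ a : ℕ, ∀ M : C, genLE G 0 M →
      ObjectProperty.extensionProduct (bigGen G (Set.Icc (-a : ℤ) a)) (genLE G (-1)) M := by
  obtain ⟨G', t, A, hG', -, h₁, h₂, h₃⟩ := hC
  have h : IsApproximatedBy t G' A := ⟨h₁, h₂, h₃⟩
  obtain ⟨N, hN⟩ := exists_bigGen_Icc hG hG'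
  obtain ⟨N', hN'⟩ := exists_bigGen_Icc hG' hG
  refine ⟨2 * A + 2 * N + N', fun M hM => ?_⟩
  have hM' : t.le (N' + A) M := by
    refine h.bigGen_Iic_le _ _ (bigGen_le_bigGen hN' (fun i hi j hj => ?_) _
      ((genLE_iff _ _ _).1 hM))
    simp only [Set.mem_Icc, Set.mem_Iic] at hi hj ⊢
    lia
  -- Descending from level `N' + A` to `-A - N - 1` suffices: passing from `t` to `G'` costs `A`,
  -- and from `G'` to `G` costs `N`, leaving `D` in degrees `≤ -1`.
  obtain ⟨E, D, f, g, k, hT, hE, hD⟩ := le_extensionProduct_iterate t.le h.le_extensionProduct _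
    (N' + A + A + N + 1) _ hM'
  refine ⟨E, D, f, g, k, hT, bigGen_le_bigGen hN (fun i hi j hj => ?_) _ hE,
    (genLE_iff _ _ _).2 (bigGen_le_bigGen hN (fun i hi j hj => ?_) _ (h.le_le_bigGen hG' _ _ hD))⟩
  · simp only [Set.mem_Icc] at hi hj ⊢
    push_cast at *
    lia
  · simp only [Set.mem_Icc, Set.mem_Iic] at hi hj ⊢
    push_cast at *
    lia

lemma genLE_le_extensionProduct {G : C} {a : ℕ} (h : ∀ M : C, genLE G 0 M →
    ObjectProperty.extensionProduct (bigGen G (Set.Icc (-a : ℤ) a)) (genLE G (-1)) M) (n : ℤ) :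
    genLE G n ≤ ObjectProperty.extensionProduct
      (bigGen G (Set.Icc (n - a) (n + a))) (genLE G (n - 1)) := by
  intro M hM
  have hM' : genLE G 0 (M⟦n⟧) := by
    rw [genLE_iff] at hM ⊢
    refine bigGen_mono _ (fun i hi => ?_) _ (bigGen_shift _ _ n hM)
    simp only [Set.mem_preimage, Set.mem_Iic] at hi ⊢
    lia
  refine extensionProduct_of_shift n (fun Y hY => ?_) (fun Y hY => ?_) (h _ hM')
  · refine bigGen_mono _ (fun i hi => ?_) _ (bigGen_shift _ _ (-n) hY)
    simp only [Set.mem_preimage, Set.mem_Icc] at hi ⊢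
    lia
  · rw [genLE_iff] at hY ⊢
    refine bigGen_mono _ (fun i hi => ?_) _ (bigGen_shift _ _ (-n) hY)
    simp only [Set.mem_preimage, Set.mem_Iic] at hi ⊢
    lia

end Approximation

/-! ### Infima of natural numbers -/

section Infima

/-- By well-ordering, a finite infimum is attained; this turns each numerical invariant into a
witness. -/
lemma iInf_natCast_eq_top_or (p : ℕ → Prop) :
    (¬ (∃ n, p n) ∧ ⨅ (n : ℕ) (_ : p n), (n : ℕ∞) = ⊤) ∨
      ∃ n, p n ∧ ⨅ (n : ℕ) (_ : p n), (n : ℕ∞) = n := by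
  classical
  by_cases h : ∃ n, p n
  · refine Or.inr ⟨Nat.find h, Nat.find_spec h, le_antisymm (iInf₂_le _ (Nat.find_spec h)) ?_⟩
    exact le_iInf₂ fun n hn => by exact_mod_cast Nat.find_min' h hn
  · exact Or.inl ⟨h, by simpa using h⟩

lemma toEReal_natCast (n : ℕ) : toEReal (n : ℕ∞) = (((n : ℤ) : ℝ) : EReal) := by
  rw [toEReal, ENat.toENNReal_coe, Int.cast_natCast]
  rfl

lemma toEReal_top : toEReal ⊤ = ⊤ := by
  simp [toEReal]

end Infima

/-! ### Boundedness and projective dimension -/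

section ProjectiveDimension

variable {C : Type u} [Category.{v} C] [Preadditive C] [HasZeroObject C] [HasShift C ℤ]
  [∀ n : ℤ, (shiftFunctor C n).Additive] [Pretriangulated C]

omit [HasZeroObject C] [Pretriangulated C] in
lemma shift_hom_eq_zero {G H : C} {p q i : ℤ} (hi : p + i = q) (h : ∀ f : G ⟶ H⟦i⟧, f = 0)
    (f : G⟦p⟧ ⟶ H⟦q⟧) : f = 0 := by
  obtain ⟨g, hg⟩ := (shiftFunctor C p).map_surjective
    (f ≫ (shiftFunctorAdd' C i p q (by lia)).hom.app H)
  rw [h g, Functor.map_zero] at hg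
  rw [← cancel_mono ((shiftFunctorAdd' C i p q (by lia)).hom.app H), ← hg, zero_comp]

omit [HasZeroObject C] [∀ n : ℤ, (shiftFunctor C n).Additive] [Pretriangulated C] in
lemma rightOrthogonal_shiftsIn_iff (G : C) (I : Set ℤ) (X : C) :
    (shiftsIn G I).rightOrthogonal X ↔ ∀ i ∈ I, ∀ f : G⟦-i⟧ ⟶ X, f = 0 :=
  ⟨fun h i hi f => h f ⟨i, hi, ⟨Iso.refl _⟩⟩, fun h Y f ⟨i, hi, ⟨e⟩⟩ => by
    rw [← cancel_epi e.inv, h i hi (e.inv ≫ f), comp_zero]⟩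

omit [HasZeroObject C] [Pretriangulated C] in
lemma rightOrthogonal_shiftsIn_shift (G : C) {I J : Set ℤ} (n : ℤ) (hIJ : ∀ i ∈ J, i + n ∈ I)
    {X : C} (h : (shiftsIn G I).rightOrthogonal X) : (shiftsIn G J).rightOrthogonal (X⟦n⟧) := by
  rw [rightOrthogonal_shiftsIn_iff] at h ⊢
  intro i hi f
  obtain ⟨g, hg⟩ := (shiftFunctor C n).map_surjective
    ((shiftFunctorAdd' C (-(i + n)) n (-i) (by lia)).inv.app G ≫ f)
  rw [h _ (hIJ i hi) g, Functor.map_zero] at hg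
  rw [← cancel_epi ((shiftFunctorAdd' C (-(i + n)) n (-i) (by lia)).inv.app G), ← hg, comp_zero]

omit [HasZeroObject C] [Pretriangulated C] in
lemma rightOrthogonal_shiftsIn_of_shift (G : C) {I J : Set ℤ} (n : ℤ) (hIJ : ∀ i ∈ J, i - n ∈ I)
    {X : C} (h : (shiftsIn G I).rightOrthogonal (X⟦n⟧)) : (shiftsIn G J).rightOrthogonal X := by
  have := rightOrthogonal_shiftsIn_shift G (-n) hIJ h
  rw [rightOrthogonal_shiftsIn_iff] at this ⊢
  intro i hi f
  rw [← cancel_mono (shiftShiftNeg X n).inv, this i hi (f ≫ _), zero_comp]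

variable [HasCoproducts.{v} C]

omit [HasZeroObject C] [Pretriangulated C] [HasCoproducts.{v} C] in
lemma genGE_iff (G : C) (n : ℤ) (X : C) :
    genGE G n X ↔ (shiftsIn G (Set.Iic (n - 1))).rightOrthogonal X := by
  rw [genGE, ObjectProperty.prop_shift_iff]
  constructor <;> intro h
  · refine rightOrthogonal_shiftsIn_of_shift G (n - 1) (fun i hi => ?_) h
    simp only [Set.mem_Iic] at hi ⊢
    lia
  · refine rightOrthogonal_shiftsIn_shift G (n - 1) (fun i hi => ?_) h
    simp only [Set.mem_Iic] at hi ⊢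
    lia

omit [HasZeroObject C]
  [∀ n : ℤ, (shiftFunctor C n).Additive] [Pretriangulated C] [HasCoproducts.{v} C] in
lemma rightOrthogonal_shiftsIn_mono (G : C) {I J : Set ℤ} (hIJ : I ⊆ J) {X : C}
    (h : (shiftsIn G J).rightOrthogonal X) : (shiftsIn G I).rightOrthogonal X :=
  fun _ f hY => h f (shiftsIn_mono G hIJ _ hY)

lemma isBoundedObject_iff (G X : C) : IsBoundedObject G X ↔
    (∃ m : ℤ, bigGen G (Set.Iic m) X) ∧ ∃ m : ℤ, (shiftsIn G (Set.Iic m)).rightOrthogonal X := by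
  constructor
  · rintro ⟨n, h₁, h₂⟩
    refine ⟨⟨n, ?_⟩, -n, ?_⟩
    · refine bigGen_mono G (fun i hi => ?_) _ (bigGen_of_shift _ _ n ((genLE_iff _ _ _).1 h₁))
      simp only [Set.mem_preimage, Set.mem_Iic] at hi ⊢
      lia
    · refine rightOrthogonal_shiftsIn_of_shift G (-n) (fun i hi => ?_) ((genGE_iff _ _ _).1 h₂)
      simp only [Set.mem_Iic] at hi ⊢
      lia
  · rintro ⟨⟨m, hm⟩, m', hm'⟩
    refine ⟨max m.toNat (-m').toNat, (genLE_iff _ _ _).2 ?_, (genGE_iff _ _ _).2 ?_⟩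
    · refine bigGen_mono G (fun i hi => ?_) _ (bigGen_shift _ _ _ hm)
      simp only [Set.mem_preimage, Set.mem_Iic] at hi ⊢
      lia
    · refine rightOrthogonal_shiftsIn_shift G _ (fun i hi => ?_) hm'
      simp only [Set.mem_Iic] at hi ⊢
      lia

lemma IsBoundedObject.shift {G X : C} (hX : IsBoundedObject G X) (n : ℤ) :
    IsBoundedObject G (X⟦n⟧) := by
  rw [isBoundedObject_iff] at hX ⊢
  obtain ⟨⟨m, hm⟩, m', hm'⟩ := hX
  refine ⟨⟨m - n, ?_⟩, m' - n, ?_⟩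
  · refine bigGen_mono G (fun i hi => ?_) _ (bigGen_shift _ _ _ hm)
    simp only [Set.mem_preimage, Set.mem_Iic] at hi ⊢
    lia
  · refine rightOrthogonal_shiftsIn_shift G _ (fun i hi => ?_) hm'
    simp only [Set.mem_Iic] at hi ⊢
    lia

lemma rightOrthogonal_of_bigGen {G : C} (hG : IsCompactObject G) {I J : Set ℤ}
    (h : ∀ i ∈ I, ∀ j ∈ J, ∀ f : G ⟶ G⟦i - j⟧, f = 0) :
    bigGen G J ≤ (shiftsIn G I).rightOrthogonal :=
  bigGen_le (closedUnderCoprodExt_rightOrthogonal (isCompactObject_of_mem_shiftsIn hG I))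
    rightOrthogonal_of_retract fun j hj => (rightOrthogonal_shiftsIn_iff _ _ _).2 fun i hi f =>
      shift_hom_eq_zero (i := i - j) (by lia) (h i hi j hj) f

/-- Dévissage in the target, where compactness of `G` handles coproducts, followed by dévissage in
the source. -/
lemma hom_eq_zero_of_bigGen {G : C} (hG : IsCompactObject G) {I J : Set ℤ}
    (h : ∀ i ∈ I, ∀ j ∈ J, ∀ f : G ⟶ G⟦i - j⟧, f = 0) {X Y : C} (hX : bigGen G I X)
    (hY : bigGen G J Y) (f : X ⟶ Y) : f = 0 := by
  refine bigGen_le (closedUnderCoprodExt_leftOrthogonal (bigGen G J)) leftOrthogonal_of_retract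
    (fun i hi Y f hY => ?_) _ hX f hY
  exact (rightOrthogonal_shiftsIn_iff _ _ _).1 (rightOrthogonal_of_bigGen hG h _ hY) i hi f

lemma isBoundedObject_of_bigGen {G : C} (hG : IsBoundedCompactGenerator G) {a b : ℤ} {X : C}
    (hX : bigGen G (Set.Icc a b) X) : IsBoundedObject G X := by
  obtain ⟨n, hn⟩ := hG.2
  refine (isBoundedObject_iff _ _).2 ⟨⟨b, bigGen_mono _ (fun i hi => hi.2) _ hX⟩, n + a,
    rightOrthogonal_of_bigGen hG.1.1 (fun i hi j hj => hn _ ?_) _ hX⟩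
  simp only [Set.mem_Icc, Set.mem_Iic] at hi hj
  lia

/-- `n` bounds the projective dimension of `X`. -/
def IsProjBound (G X : C) (n : ℤ) : Prop :=
  ∀ i : ℤ, n < i → ∀ Y : C, IsBoundedObject G Y → genLE G 0 Y → ∀ f : X ⟶ Y⟦i⟧, f = 0

lemma IsProjBound.projDim_le {G X : C} {n : ℤ} (h : IsProjBound G X n) :
    projDim G X ≤ (((n : ℤ) : ℝ) : EReal) :=
  iInf₂_le n h

lemma exists_isProjBound_of_lt {G X : C} {x : EReal} (h : projDim G X < x) :
    ∃ n : ℤ, IsProjBound G X n ∧ ((n : ℝ) : EReal) < x := by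
  simpa only [projDim, iInf_lt_iff, exists_prop] using! h

/-- Some integer bound lies strictly below `n + 1`, hence is at most `n`, and bounds persist
upwards. -/
lemma isProjBound_of_projDim_le {G X : C} {n : ℤ}
    (h : projDim G X ≤ (((n : ℤ) : ℝ) : EReal)) : IsProjBound G X n := by
  obtain ⟨m, hm, hmn⟩ := exists_isProjBound_of_lt
    (h.trans_lt (show ((n : ℝ) : EReal) < (((n + 1 : ℤ) : ℝ) : EReal) by
      rw [EReal.coe_lt_coe_iff]; exact_mod_cast lt_add_one n))
  rw [EReal.coe_lt_coe_iff, Int.cast_lt] at hmn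
  exact fun i hi => hm i (by lia)

lemma projDim_lt_top_iff (G X : C) : projDim G X < ⊤ ↔ ∃ n : ℤ, IsProjBound G X n :=
  ⟨fun h => (exists_isProjBound_of_lt h).imp fun _ h => h.1,
    fun ⟨_, h⟩ => h.projDim_le.trans_lt (EReal.coe_lt_top _)⟩

lemma projDim_eq_bot_iff (G X : C) : projDim G X = ⊥ ↔ ∀ n : ℤ, IsProjBound G X n :=
  ⟨fun h _ => isProjBound_of_projDim_le (h ▸ bot_le), fun h => by
    refine EReal.eq_bot_iff_forall_lt _ |>.2 fun y => ?_
    obtain ⟨n, hn⟩ := exists_int_lt y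
    exact (h n).projDim_le.trans_lt (EReal.coe_lt_coe hn)⟩

/-- A suitable shift `M[m]` is itself a test object, so the identity of `M`, read as a map to
`(M[m])[-m]`, must vanish. -/
lemma projDim_eq_bot_iff_isZero {G M : C} (hM : IsBoundedObject G M) :
    projDim G M = ⊥ ↔ IsZero M := by
  rw [projDim_eq_bot_iff]
  refine ⟨fun h => ?_, fun h _ _ _ _ _ _ f => h.eq_of_src _ _⟩
  obtain ⟨⟨m, hm⟩, -⟩ := (isBoundedObject_iff _ _).1 hM
  have h₀ : genLE G 0 (M⟦m⟧) := by
    refine (genLE_iff _ _ _).2 (bigGen_mono G (fun i hi => ?_) _ (bigGen_shift _ _ _ hm))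
    simp only [Set.mem_preimage, Set.mem_Iic] at hi ⊢
    lia
  have := h (-m - 1) (-m) (by lia) _ (hM.shift m) h₀ (shiftShiftNeg M m).inv
  rw [IsZero.iff_id_eq_zero, ← (shiftShiftNeg M m).inv_hom_id, this, zero_comp]

lemma isProjBound_of_bigGen_Ici {G : C} (hG : IsCompactObject G) {c : ℤ}
    (hc : ∀ i : ℤ, c < i → ∀ f : G ⟶ G⟦i⟧, f = 0) {a : ℤ} {X : C}
    (hX : bigGen G (Set.Ici a) X) : IsProjBound G X (c - a) := by
  intro i hi Y _ hY f
  refine hom_eq_zero_of_bigGen hG (fun j hj k hk => hc _ ?_) hX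
    (bigGen_shift _ _ i ((genLE_iff _ _ _).1 hY)) f
  simp only [Set.mem_Ici, Set.mem_preimage, Set.mem_Iic] at hj hk
  lia

/-- A bounded object of projective dimension at most `n` is a direct summand of its
approximations. -/
lemma IsProjBound.bigGen_Icc [IsTriangulated C] {G : C} (hG : IsBoundedCompactGenerator G) {a : ℕ}
    (ha : ∀ M : C, genLE G 0 M →
      ObjectProperty.extensionProduct (bigGen G (Set.Icc (-a : ℤ) a)) (genLE G (-1)) M)
    {M : C} (hM : IsBoundedObject G M) {n : ℤ} (hn : IsProjBound G M n) :
    ∃ b : ℤ, bigGen G (Set.Icc (-n - a) b) M := by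
  obtain ⟨⟨m, hm⟩, m', hm'⟩ := (isBoundedObject_iff _ _).1 hM
  -- The number of steps from level `max m (-n)` down to `-n - 1`; the maximum keeps it nonnegative.
  obtain ⟨k, hk⟩ : ∃ k : ℕ, (k : ℤ) = max m (-n) + n + 1 := ⟨_, Int.toNat_of_nonneg (by lia)⟩
  have hm₁ : genLE G (max m (-n)) M :=
    (genLE_iff _ _ _).2 (bigGen_mono _ (Set.Iic_subset_Iic.2 (le_max_left _ _)) _ hm)
  obtain ⟨E, D, f, g, δ, hT, hE, hD⟩ :=
    le_extensionProduct_iterate (genLE G) (genLE_le_extensionProduct ha) _ k _ hm₁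
  rw [genLE_iff, hk] at hD
  -- Only bounded objects may test `M`. `D` is bounded below because it lies between `M` and `E[1]`;
  -- for `E` this uses that `G` is bounded.
  have hDb : IsBoundedObject G D := by
    obtain ⟨-, l, hl⟩ := (isBoundedObject_iff _ _).1 ((isBoundedObject_of_bigGen hG hE).shift 1)
    refine (isBoundedObject_iff _ _).2 ⟨⟨_, hD⟩, min m' l, ?_⟩
    exact (closedUnderCoprodExt_rightOrthogonal (isCompactObject_of_mem_shiftsIn hG.1.1 _)).ext _
      (rot_of_distTriang _ hT)
      (rightOrthogonal_shiftsIn_mono G (Set.Iic_subset_Iic.2 (min_le_left _ _)) hm')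
      (rightOrthogonal_shiftsIn_mono G (Set.Iic_subset_Iic.2 (min_le_right _ _)) hl)
  have hg : g = 0 := by
    have h₀ : genLE G 0 (D⟦-(n + 1)⟧) := by
      refine (genLE_iff _ _ _).2 (bigGen_mono G (fun i hi => ?_) _ (bigGen_shift _ _ _ hD))
      simp only [Set.mem_preimage, Set.mem_Iic] at hi ⊢
      lia
    rw [← cancel_mono (shiftNegShift D (n + 1)).inv, zero_comp]
    exact hn (n + 1) (by lia) _ (hDb.shift _) h₀ _
  obtain ⟨s, hs⟩ := Triangle.coyoneda_exact₂ _ hT (𝟙 M) (by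
    change 𝟙 M ≫ g = 0
    rw [hg, comp_zero])
  obtain ⟨Z, hZ, ⟨r⟩⟩ := hE
  refine ⟨max m (-n) + a, bigGen_mono G ?_ _
    ⟨Z, hZ, ⟨(Retract.mk s f hs.symm).trans r⟩⟩⟩
  exact Set.Icc_subset_Icc (by lia) (by lia)

/-- The self-orthogonality of a compact generator in a weakly approximable category. -/
lemma exists_forall_hom_eq_zero [IsTriangulated C] (hC : IsWeaklyApproximable C) {G : C}
    (hG : IsCompactGenerator G) : ∃ c : ℕ, ∀ i : ℤ, (c : ℤ) < i → ∀ f : G ⟶ G⟦i⟧, f = 0 := by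
  obtain ⟨G', t, A, hG', -, h₁, h₂, h₃⟩ := hC
  have h : IsApproximatedBy t G' A := ⟨h₁, h₂, h₃⟩
  obtain ⟨N, hN⟩ := exists_bigGen_Icc hG' hG
  -- `G` lies in `t.le (N + A)` and has no nonzero maps to `t.le (-N - A)`; `G[i]` lies in the
  -- latter once `i ≥ 2N + 2A`.
  refine ⟨2 * N + 2 * A, fun i hi f => ?_⟩
  have h₁ : (t.le (-N - A)).leftOrthogonal G :=
    bigGen_le (closedUnderCoprodExt_leftOrthogonal (t.le (-N - A))) leftOrthogonal_of_retract
      (fun i hi Y f hY => h.hom_eq_zero' (by simp only [Set.mem_Icc] at hi; lia) hY f) _ hN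
  have h₂ : t.le (N + A) G := h.bigGen_Iic_le _ _ (bigGen_mono _ (fun i hi => hi.2) _ hN)
  exact h₁ f (t.le_monotone (by push_cast at hi; lia) _ (t.le_shift _ i (N + A - i) (by lia) _ h₂))

lemma projDim_lt_top_iff_isStronglyBounded [IsTriangulated C] (hC : IsWeaklyApproximable C) {G : C}
    (hG : IsBoundedCompactGenerator G) {M : C} (hM : IsBoundedObject G M) :
    projDim G M < ⊤ ↔ IsStronglyBounded G M := by
  rw [projDim_lt_top_iff]
  constructor
  · rintro ⟨n, hn⟩
    obtain ⟨a, ha⟩ := exists_forall_genLE hC hG.1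
    obtain ⟨b, hb⟩ := hn.bigGen_Icc hG ha hM
    exact ⟨max (n + a).toNat b.toNat,
      bigGen_mono _ (Set.Icc_subset_Icc (by lia) (by lia)) _ hb⟩
  · rintro ⟨i, hi⟩
    obtain ⟨c, hc⟩ := exists_forall_hom_eq_zero hC hG.1
    exact ⟨_, isProjBound_of_bigGen_Ici hG.1.1 hc (bigGen_mono _ (fun j hj => hj.1) _ hi)⟩

end ProjectiveDimension

/-! ### Comparison of the two finitistic dimensions -/

section FinitisticDimension

variable {C : Type u} [Category.{v} C] [Preadditive C] [HasZeroObject C] [HasShift C ℤ]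
  [∀ n : ℤ, (shiftFunctor C n).Additive] [Pretriangulated C]

lemma NonnegGen.of_iso {G X Y : C} (e : X ≅ Y) (hX : NonnegGen G X) : NonnegGen G Y :=
  .retract _ _ e.symm.retract hX

lemma NonnegGen.shift_neg (G : C) (n : ℕ) : NonnegGen G (G⟦-(n : ℤ)⟧) := by
  induction n with
  | zero => exact NonnegGen.base.of_iso ((shiftFunctorZero' C (-((0 : ℕ) : ℤ)) (by simp)).app G).symm
  | succ n ih =>
    exact ih.shift.of_iso
      ((shiftFunctorAdd' C (-(n : ℤ)) (-1) (-((n + 1 : ℕ) : ℤ)) (by lia)).app G).symm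

variable [HasCoproducts.{v} C]

/-- The shift of a compact object, computed in the ambient category. -/
noncomputable def compactsShiftIso (X : Compacts C) (n : ℤ) : (X⟦n⟧).obj ≅ X.obj⟦n⟧ :=
  (IsCompactObject.ι.commShiftIso n).app X

lemma NonnegGen.bigGen_Ici {G : C} (hG : IsCompactObject G) {X : Compacts C}
    (hX : NonnegGen (C := Compacts C) ⟨G, hG⟩ X) : bigGen G (Set.Ici 0) X.obj := by
  have hQ := closedUnderCoprodExt_bigGen G (Set.Ici 0)
  induction hX with
  | base =>
    exact coprod_le_bigGen _ _ _
      (.base _ ⟨0, Set.self_mem_Ici, ⟨((shiftFunctorZero' C (-0 : ℤ) (by simp)).app G).symm⟩⟩)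
  | shift X _ ih =>
    refine hQ.of_iso (compactsShiftIso X (-1)).symm
      (bigGen_mono G (fun i hi => ?_) _ (bigGen_shift G _ (-1) ih))
    simp only [Set.mem_preimage, Set.mem_Ici] at hi ⊢
    lia
  | retract X Y r _ ih =>
    obtain ⟨Z, hZ, ⟨r'⟩⟩ := ih
    exact ⟨Z, hZ, ⟨(r.map IsCompactObject.ι).trans r'⟩⟩
  | ext T hT _ _ h₁ h₃ =>
    exact hQ.ext _ (IsCompactObject.ι.map_distinguished T hT) h₁ h₃

/-- Compactness replaces infinite constructions by finite ones: `X` is a summand of an object built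
by finitely many extensions, all within the compact objects. -/
lemma nonnegGen_of_bigGen_Ici {G : C} (hG : IsCompactObject G) (X : Compacts C)
    (hX : bigGen G (Set.Ici 0) X.obj) : NonnegGen (C := Compacts C) ⟨G, hG⟩ X := by
  obtain ⟨E, ⟨hE, hE'⟩, ⟨r⟩⟩ := exists_retract (P := shiftsIn G (Set.Ici 0))
    (Q := fun Z => ∃ h : IsCompactObject Z, NonnegGen (C := Compacts C) ⟨G, hG⟩ ⟨Z, h⟩)
    (fun Z hZ => by
      refine ⟨isCompactObject_of_mem_shiftsIn hG _ _ hZ, ?_⟩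
      obtain ⟨i, hi, ⟨e⟩⟩ := hZ
      obtain ⟨n, rfl⟩ := Int.eq_ofNat_of_zero_le hi
      exact (NonnegGen.shift_neg (C := Compacts C) ⟨G, hG⟩ n).of_iso
        (ObjectProperty.isoMk _ (compactsShiftIso _ _ ≪≫ e.symm)))
    (fun _ h => h.1)
    ⟨ObjectProperty.prop_zero _, .retract _ ⟨G, hG⟩ ⟨0, 0,
      IsCompactObject.ι.map_injective ((isZero_zero C).eq_of_src _ _)⟩ .base⟩
    (fun T hT ⟨h₁, h₁'⟩ ⟨h₃, h₃'⟩ => by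
      have h₂ := ObjectProperty.ext_of_isTriangulatedClosed₂ IsCompactObject T hT h₁ h₃
      let T' : Triangle (Compacts C) := Triangle.mk (X := ⟨_, h₁⟩) (Y := ⟨_, h₂⟩) (Z := ⟨_, h₃⟩)
        (ObjectProperty.homMk T.mor₁) (ObjectProperty.homMk T.mor₂)
        (ObjectProperty.homMk (T.mor₃ ≫ (compactsShiftIso ⟨_, h₁⟩ 1).inv))
      refine ⟨h₂, .ext T' ?_ h₁' h₃'⟩
      exact isomorphic_distinguished _ hT _
        (Triangle.isoMk _ _ (Iso.refl _) (Iso.refl _) (Iso.refl _)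
          ((Category.comp_id _).trans (Category.id_comp _).symm)
          ((Category.comp_id _).trans (Category.id_comp _).symm) (by
            change ((T.mor₃ ≫ (compactsShiftIso ⟨_, h₁⟩ 1).inv) ≫
              (compactsShiftIso ⟨_, h₁⟩ 1).hom) ≫
              (𝟙 T.obj₁)⟦(1 : ℤ)⟧' = 𝟙 T.obj₃ ≫ T.mor₃
            simp)))
    X.property hX
  let i : X ⟶ ⟨E, hE⟩ := ObjectProperty.homMk r.i
  let p : ⟨E, hE⟩ ⟶ X := ObjectProperty.homMk r.r
  exact .retract _ _ ⟨i, p, ObjectProperty.hom_ext _ r.retract⟩ hE'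

lemma rightOrthogonal_compacts_iff {G : C} (hG : IsCompactObject G) (I : Set ℤ)
    (X : Compacts C) : (shiftsIn (C := Compacts C) ⟨G, hG⟩ I).rightOrthogonal X ↔
      (shiftsIn G I).rightOrthogonal X.obj := by
  rw [rightOrthogonal_shiftsIn_iff, rightOrthogonal_shiftsIn_iff]
  refine forall₂_congr fun i _ => ⟨fun h f => ?_, fun h f => ?_⟩
  · have := h (ObjectProperty.homMk ((compactsShiftIso ⟨G, hG⟩ (-i)).hom ≫ f))
    rw [← cancel_epi (compactsShiftIso ⟨G, hG⟩ (-i)).hom, comp_zero]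
    exact congrArg (fun g => g.hom) this
  · apply IsCompactObject.ι.map_injective
    have := h ((compactsShiftIso ⟨G, hG⟩ (-i)).inv ≫ f.hom)
    rw [← cancel_epi (compactsShiftIso ⟨G, hG⟩ (-i)).inv, Functor.map_zero, comp_zero]
    exact this

/-- The condition on `n` in the definition of the finitistic dimension of the category of
compact objects. -/
lemma findim_condition_iff {G : C} (hG : IsCompactObject G) (n : ℕ) :
    (shiftsIn (C := Compacts C) ⟨G, hG⟩ (Set.Iic (-1))).rightOrthogonal ≤
      ObjectProperty.shift (NonnegGen (C := Compacts C) ⟨G, hG⟩) (-(n : ℤ)) ↔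
    ∀ X : C, IsCompactObject X → genGE G 0 X → bigGen G (Set.Ici (-n : ℤ)) X := by
  constructor
  · intro h X hX hX'
    have := NonnegGen.bigGen_Ici hG (h ⟨X, hX⟩ ((rightOrthogonal_compacts_iff hG _ _).2
      ((genGE_iff _ _ _).1 hX')))
    refine bigGen_mono _ (fun i hi => ?_) _ (bigGen_of_shift _ _ (-(n : ℤ))
      ((closedUnderCoprodExt_bigGen _ _).of_iso (compactsShiftIso ⟨X, hX⟩ _) this))
    simp only [Set.mem_preimage, Set.mem_Ici] at hi ⊢
    lia
  · intro h X hX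
    have := h X.obj X.property ((genGE_iff _ _ _).2 ((rightOrthogonal_compacts_iff hG _ _).1 hX))
    refine nonnegGen_of_bigGen_Ici hG _ ((closedUnderCoprodExt_bigGen _ _).of_iso
      (compactsShiftIso X _).symm (bigGen_mono _ (fun i hi => ?_) _
        (bigGen_shift _ _ (-(n : ℤ)) this)))
    simp only [Set.mem_preimage, Set.mem_Ici] at hi ⊢
    lia

lemma findim_eq_top_or {G : C} (hG : IsCompactObject G) :
    findim (C := Compacts C) ⟨G, hG⟩ = ⊤ ∨ ∃ n : ℕ, findim (C := Compacts C) ⟨G, hG⟩ = n ∧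
      ∀ X : C, IsCompactObject X → genGE G 0 X → bigGen G (Set.Ici (-n : ℤ)) X := by
  rcases iInf_natCast_eq_top_or fun n : ℕ =>
    (shiftsIn (C := Compacts C) ⟨G, hG⟩ (Set.Iic (-1))).rightOrthogonal ≤
      ObjectProperty.shift (NonnegGen (C := Compacts C) ⟨G, hG⟩) (-(n : ℤ)) with h | ⟨n, hn, h⟩
  · exact Or.inl h.2
  · exact Or.inr ⟨n, h, (findim_condition_iff hG n).1 hn⟩

lemma findim_le {G : C} (hG : IsCompactObject G) {n : ℕ}
    (h : ∀ X : C, IsCompactObject X → genGE G 0 X → bigGen G (Set.Ici (-n : ℤ)) X) :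
    findim (C := Compacts C) ⟨G, hG⟩ ≤ n :=
  iInf₂_le n ((findim_condition_iff hG n).2 h)

lemma exists_upperIndex [IsTriangulated C] (hC : IsWeaklyApproximable C) {G : C}
    (hG : IsCompactGenerator G) :
    ∃ c : ℕ, upperIndex G = c ∧ ∀ i : ℤ, (c : ℤ) < i → ∀ f : G ⟶ G⟦i⟧, f = 0 := by
  rcases iInf_natCast_eq_top_or fun c : ℕ => ∀ i : ℤ, (c : ℤ) < i → ∀ f : G ⟶ G⟦i⟧, f = 0
    with h | ⟨c, hc, h⟩
  · exact absurd (exists_forall_hom_eq_zero hC hG) h.1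
  · exact ⟨c, h, hc⟩

/-- The supremum is finite by uniform approximability, and widening intervals makes its value work
for every `M` at once. -/
lemma exists_approxIndex [IsTriangulated C] (hC : IsWeaklyApproximable C) {G : C}
    (hG : IsCompactGenerator G) : ∃ a : ℕ, approxIndex G = a ∧ ∀ M : C, genLE G 0 M →
      ObjectProperty.extensionProduct (bigGen G (Set.Icc (-a : ℤ) a)) (genLE G (-1)) M := by
  obtain ⟨a₀, h₀⟩ := exists_forall_genLE hC hG
  have h₁ : approxIndex G ≤ a₀ := iSup₂_le fun M hM => iInf₂_le a₀ (h₀ M hM)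
  obtain ⟨a, ha⟩ := ENat.ne_top_iff_exists.1 (h₁.trans_lt (ENat.natCast_lt_top a₀)).ne
  refine ⟨a, ha.symm, fun M hM => ?_⟩
  have hle : approxIndexObj G M ≤ a := ha ▸ le_iSup₂ (f := fun M _ => approxIndexObj G M) M hM
  rcases iInf_natCast_eq_top_or fun n : ℕ => ObjectProperty.extensionProduct
    (bigGen G (Set.Icc (-n : ℤ) n)) (genLE G (-1)) M with h | ⟨n, hn, h⟩
  · exact absurd ⟨a₀, h₀ M hM⟩ h.1
  · have hna : n ≤ a := by
      rw [approxIndexObj, h] at hle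
      exact_mod_cast hle
    exact ObjectProperty.monotone_extensionProduct_left _
      (bigGen_mono _ (Set.Icc_subset_Icc (by lia) (by lia))) _ hn

lemma IsCompactObject.isBoundedObject {G : C} (hG : IsBoundedCompactGenerator G) {X : C}
    (hX : IsCompactObject X) : IsBoundedObject G X := by
  obtain ⟨N, hN⟩ := hG.1.1.exists_bigGen_Icc hX (hG.1.2 X)
  exact isBoundedObject_of_bigGen hG hN

lemma IsCompactObject.projDim_lt_top [IsTriangulated C] (hC : IsWeaklyApproximable C) {G : C}
    (hG : IsBoundedCompactGenerator G) {X : C} (hX : IsCompactObject X) : projDim G X < ⊤ :=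
  (projDim_lt_top_iff_isStronglyBounded hC hG (hX.isBoundedObject hG)).2
    (hG.1.1.exists_bigGen_Icc hX (hG.1.2 X))

/-- Compact objects are strongly bounded, so the boundedness and finiteness conditions in `fpd` hold
automatically. -/
lemma IsCompactObject.projDim_le_fpd [IsTriangulated C] (hC : IsWeaklyApproximable C) {G : C}
    (hG : IsBoundedCompactGenerator G) {X : C} (hX : IsCompactObject X) (hX' : genGE G 0 X) :
    projDim G X ≤ fpd G :=
  le_iSup₂ (f := fun X _ => projDim G X) X
    ⟨hX, hX.isBoundedObject hG, hX', hX.projDim_lt_top hC hG⟩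

lemma findim_le_fpd_add_approxIndex [IsTriangulated C] (hC : IsWeaklyApproximable C) {G : C}
    (hG : IsBoundedCompactGenerator G) : toEReal (findim (C := Compacts C) ⟨G, hG.1.1⟩) ≤
      max 0 (fpd G + toEReal (approxIndex G)) := by
  obtain ⟨a, ha, ha'⟩ := exists_approxIndex hC hG.1
  rw [ha, toEReal_natCast]
  -- The strict inequality yields integer bounds `m ≤ n - a` without knowing that `fpd G` is an
  -- integer, and also covers `fpd G = ⊥`.
  have key : ∀ n : ℕ, fpd G < (((n + 1 - a : ℤ) : ℝ) : EReal) →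
      toEReal (findim (C := Compacts C) ⟨G, hG.1.1⟩) ≤ (((n : ℤ) : ℝ) : EReal) := by
    intro n hn
    rw [← toEReal_natCast]
    refine EReal.coe_ennreal_le_coe_ennreal_iff.2 (ENat.toENNReal_le.2
      (findim_le _ fun X hX hX' => ?_))
    obtain ⟨m, hm, hmn⟩ := exists_isProjBound_of_lt ((hX.projDim_le_fpd hC hG hX').trans_lt hn)
    rw [EReal.coe_lt_coe_iff, Int.cast_lt] at hmn
    obtain ⟨b, hb⟩ := hm.bigGen_Icc hG ha' (hX.isBoundedObject hG)
    exact bigGen_mono _ (fun i hi => by simp only [Set.mem_Icc, Set.mem_Ici] at hi ⊢; lia) _ hb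
  induction h : fpd G using EReal.rec with
  | bot =>
    have := key 0 (h ▸ EReal.bot_lt_coe _)
    exact le_max_of_le_left (by simpa using this)
  | top =>
    rw [EReal.top_add_coe]
    exact le_max_of_le_right le_top
  | coe r =>
    have h₀ : (0 : ℝ) ≤ max 0 (r + a) := le_max_left _ _
    refine (key ⌊max 0 (r + a)⌋₊ ?_).trans ?_
    · rw [h, EReal.coe_lt_coe_iff]
      have h₁ := Nat.lt_floor_add_one (max 0 (r + a))
      have h₂ := le_max_right 0 (r + a)
      push_cast
      linarith
    · rw [← EReal.coe_add, ← EReal.coe_zero, ← EReal.coe_strictMono.monotone.map_max,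
        EReal.coe_le_coe_iff]
      exact_mod_cast Nat.floor_le h₀

lemma fpd_le_findim_add_upperIndex [IsTriangulated C] (hC : IsWeaklyApproximable C) {G : C}
    (hG : IsBoundedCompactGenerator G) :
    fpd G ≤ toEReal (findim (C := Compacts C) ⟨G, hG.1.1⟩) + toEReal (upperIndex G) := by
  obtain ⟨c, hc, hc'⟩ := exists_upperIndex hC hG.1
  rw [hc, toEReal_natCast]
  rcases findim_eq_top_or hG.1.1 with h | ⟨n, h, hn⟩
  · rw [h, toEReal_top, EReal.top_add_coe]
    exact le_top
  · rw [h, toEReal_natCast, ← EReal.coe_add, ← Int.cast_add]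
    refine iSup₂_le fun X hX => IsProjBound.projDim_le ?_
    have := isProjBound_of_bigGen_Ici hG.1.1 hc' (hn X hX.1 hX.2.2.1)
    rwa [sub_neg_eq_add, add_comm] at this

lemma findim_lt_top_iff [IsTriangulated C] (hC : IsWeaklyApproximable C) {G : C}
    (hG : IsBoundedCompactGenerator G) :
    findim (C := Compacts C) ⟨G, hG.1.1⟩ < ⊤ ↔ fpd G < ⊤ := by
  constructor
  · intro h
    refine (fpd_le_findim_add_upperIndex hC hG).trans_lt ?_
    obtain ⟨c, hc, -⟩ := exists_upperIndex hC hG.1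
    obtain ⟨n, hn⟩ := ENat.ne_top_iff_exists.1 h.ne
    rw [hc, ← hn, toEReal_natCast, toEReal_natCast, ← EReal.coe_add]
    exact EReal.coe_lt_top _
  · intro h
    rw [lt_top_iff_ne_top]
    intro h'
    have := findim_le_fpd_add_approxIndex hC hG
    obtain ⟨a, ha, -⟩ := exists_approxIndex hC hG.1
    rw [h', ha, toEReal_top, toEReal_natCast, top_le_iff] at this
    refine (max_lt (EReal.coe_lt_top 0) ?_).ne this
    exact EReal.add_lt_top h.ne (EReal.coe_ne_top _)

/-- Since `G` is bounded, a suitable shift of it lies in degrees `≥ 0`; being nonzero, it has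
projective dimension above `⊥`. -/
lemma bot_lt_fpd [IsTriangulated C] (hC : IsWeaklyApproximable C) {G : C}
    (hG : IsBoundedCompactGenerator G) (h₀ : ¬ IsZero G) : ⊥ < fpd G := by
  obtain ⟨n, hn⟩ := hG.2
  have hX : IsCompactObject (G⟦n + 1⟧) := hG.1.1.shift _
  have hX' : genGE G 0 (G⟦n + 1⟧) := by
    rw [genGE_iff, rightOrthogonal_shiftsIn_iff]
    intro i hi f
    simp only [Set.mem_Iic] at hi
    exact shift_hom_eq_zero (i := n + 1 + i) (by lia) (hn _ (by lia)) f
  refine lt_of_lt_of_le ?_ (hX.projDim_le_fpd hC hG hX')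
  rw [bot_lt_iff_ne_bot, ne_eq, projDim_eq_bot_iff_isZero (hX.isBoundedObject hG)]
  exact fun h => h₀ (((shiftFunctor C (-(n + 1))).map_isZero h).of_iso
    (shiftShiftNeg G (n + 1)).symm)

/-- Projective dimensions below `⌊r⌋ + 1` are at most `⌊r⌋`, so a real supremum equals its floor. -/
lemma exists_fpd_eq_intCast {G : C} (h : fpd G < ⊤) (h' : ⊥ < fpd G) :
    ∃ m : ℤ, fpd G = ((m : ℝ) : EReal) := by
  induction hr : fpd G using EReal.rec with
  | bot => exact absurd hr h'.ne'
  | top => exact absurd hr h.ne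
  | coe r =>
    refine ⟨⌊r⌋, le_antisymm (hr ▸ iSup₂_le fun X hX => ?_)
      (EReal.coe_le_coe_iff.2 (Int.floor_le r))⟩
    have hle : projDim G X ≤ fpd G := le_iSup₂ (f := fun X _ => projDim G X) X hX
    have hlt : fpd G < (((⌊r⌋ + 1 : ℤ) : ℝ) : EReal) := by
      rw [hr, EReal.coe_lt_coe_iff]
      exact_mod_cast Int.lt_floor_add_one r
    obtain ⟨m, hm, hm'⟩ := exists_isProjBound_of_lt (hle.trans_lt hlt)
    rw [EReal.coe_lt_coe_iff, Int.cast_lt] at hm'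
    exact hm.projDim_le.trans (EReal.coe_le_coe_iff.2 (by exact_mod_cast Int.lt_add_one_iff.1 hm'))

end FinitisticDimension

end FinDimTri

-- As `G` generates, `¬ IsZero G` expresses that the category is nonzero.
open FinDimTri in
theorem proposition1p5 {C : Type u} [Category.{v} C] [Preadditive C] [HasZeroObject C]
    [HasShift C ℤ] [∀ n : ℤ, (shiftFunctor C n).Additive] [Pretriangulated C]
    [IsTriangulated C] [HasCoproducts.{v} C] (hC : IsWeaklyApproximable C)
    (G : C) (hG : IsBoundedCompactGenerator G) :
    (∀ M : C, IsBoundedObject G M →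
      ((projDim G M < ⊤ ↔ IsStronglyBounded G M) ∧ (projDim G M = ⊥ ↔ IsZero M))) ∧
    toEReal (findim (C := Compacts C) ⟨G, hG.1.1⟩) ≤
      max 0 (fpd G + toEReal (approxIndex G)) ∧
    fpd G ≤ toEReal (findim (C := Compacts C) ⟨G, hG.1.1⟩) + toEReal (upperIndex G) ∧
    (findim (C := Compacts C) ⟨G, hG.1.1⟩ < ⊤ ↔ fpd G < ⊤) ∧
    (¬ IsZero G →
      (findim (C := Compacts C) ⟨G, hG.1.1⟩ < ⊤ ↔ ∃ m : ℤ, fpd G = ((m : ℝ) : EReal))) := by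
  refine ⟨fun M hM => ⟨projDim_lt_top_iff_isStronglyBounded hC hG hM,
    projDim_eq_bot_iff_isZero hM⟩, findim_le_fpd_add_approxIndex hC hG,
    fpd_le_findim_add_upperIndex hC hG, findim_lt_top_iff hC hG, fun h₀ => ?_⟩
  rw [findim_lt_top_iff hC hG]
  refine ⟨fun h => exists_fpd_eq_intCast h (bot_lt_fpd hC hG h₀), ?_⟩
  rintro ⟨m, hm⟩
  rw [hm]
  exact EReal.coe_lt_top _
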